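/- All monoids are commutative, cancellative and torsion free, and $\mathbb N=\{1,2,\dots\}$, $\mathbb Z_+=\{0,1,2,\dots\}$. Let $\mathrm{gp}(N)$ be the group of differences of a monoid $N$. A monoid $N$ is *normal* if $x\in \mathrm{gp}(N)$, $kx\in N$ for some $k\in\mathbb N$ imply $x\in N$. Let $N$ be a finitely generated normal monoid without nontrivial units, regarded as a submonoid of $E=\mathbb R\otimes\mathrm{gp}(N)$; all monoids below are submonoids of $E$. For a submonoid $L$ put $C(L)=\mathbb R_+L$. Fix a rational affine hyperplane $H\subset E\setminus\{0\}$ meeting every ray of $C(N)$, and put $\Phi(L)=C(L)\cap H$ for $L\subset C(N)$. For a convex set $W$ put $L(W)=L\cap\mathbb R_+W$. Let $\mathrm{int}$ of a convex set be its relative interior, $\mathrm{int}(L)=L\cap\mathrm{int}(C(L))$ and $L_*=\mathrm{int}(L)\cup\{0\}$. For a sequence $\mathfrak c=(c_1,c_2,\dots)$ of natural numbers $\ge 2$ put $L^{\mathfrak c}=\bigcup_j \frac{L}{c_1\cdots c_j}$ and $L^{\mathfrak c}_*=(L^{\mathfrak c})_*$. An extension $M\subset N$ is *pyramidal* if $M$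 and $N$ are finitely generated normal monoids without nontrivial units, $\mathrm{gp}(M)=\mathrm{gp}(N)$, and $\Phi(N)=\Phi(M)\cup\delta$ for some rational pyramid $\delta$ (the convex hull of one of its facets, the base, and a vertex not in it) such that $\dim\Phi(N)=\dim\Phi(M)=\dim\delta$ and $\Phi(M)\cap\delta$ is the base of $\delta$. A *polarized monoid* is a triple $(t,\Gamma,L)$ where $L$ is a finitely generated normal monoid without nontrivial units, $\Gamma\subset\Phi(L)$ is a rational polytope with $\dim\Gamma=\dim\Phi(L)$, and $t\in L$ is a nonzero element with $t\notin\mathbb R_+\Gamma$, such that 1. $C(L)=\mathbb R_+t+\mathbb R_+\Gamma$, 2. for every facet $F\subset\Gamma$ the map $(k,y)\mapsto kt+y$ is an isomorphism $\mathbb Z_+\times L(F)\to L\cap(\mathbb R_+t+\mathbb R_+F)$. **Theorem.** Let $M\subset N$ be a pyramidal extension, let $\mathfrak c$ be a sequence of natural numbers $\ge2$ and let $s\ge1$ be a natural number. Then there are systems of polarized monoids $(t_\alpha,\Gamma_{1\alpha},N_{1\alpha}),\dots,(t_\alpha,\Gamma_{s\alpha},N_{s\alpha})$, $\alpha\in\mathbb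 N$, such that (a) $N_{1\alpha}\subset\cdots\subset N_{s\alpha}\subset N^{\mathfrak c}_*$ and $\Gamma_{1\alpha}\subset\cdots\subset\Gamma_{s\alpha}\subset\mathrm{int}(\Phi(M))$ for every $\alpha$; (b) $\pm t_\alpha+(N_{l\alpha}(\Gamma_{l\alpha})\setminus\{0\})\subset\mathrm{int}(N_{l+1,\alpha}(\Gamma_{l+1,\alpha}))$ for every $1\le l\le s-1$ and every $\alpha$; (c) $M^{\mathfrak c}_*$ is the filtered union of the monoids $N_{1\alpha}(\Gamma_{1\alpha})$, and $N^{\mathfrak c}_*$ is the filtered union of the monoids $N_{1\alpha}$ ($\alpha\in\mathbb N$); that is, each of the two families is directed by inclusion and has the stated union. -/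

import Mathlib

/-!
Geometry of affine monoids, inside a finite dimensional real vector space `E`.
A (commutative, cancellative, torsion free) monoid `N` is regarded as an additive submonoid of
`E = ℝ ⊗ gp(N)`.
-/

namespace MonoidGeom

variable {E : Type*} [NormedAddCommGroup E] [NormedSpace ℝ E]

/-- The group of differences `gp(N)`, as a subgroup of the ambient space. -/
def gp (N : AddSubmonoid E) : AddSubgroup E := AddSubgroup.closure (N : Set E)

/-- The cone `ℝ₊ W` with vertex at the origin spanned by a set `W`. -/
def cone (W : Set E) : PointedCone ℝ E := PointedCone.hull ℝ W

/-- Finitely generated normal monoids without nontrivial units. The group of differences is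
required to be discrete in `E`, i.e. `ℝ ⊗ gp(N) → E` is injective. -/
structure IsAffineNormal (N : AddSubmonoid E) : Prop where
  fg : N.FG
  discrete : DiscreteTopology (gp N)
  normal : ∀ x ∈ gp N, ∀ k : ℕ, 0 < k → k • x ∈ N → x ∈ N
  units : ∀ x ∈ N, -x ∈ N → x = 0

/-- The functional `φ` defines a rational hyperplane `H = {φ = 1}`, not containing the origin,
which cuts every ray of the cone `C(N) = ℝ₊ N`. -/
structure IsCrossSection (φ : E →ₗ[ℝ] ℝ) (N : AddSubmonoid E) : Prop where
  rational : ∀ x ∈ N, ∃ q : ℚ, φ x = q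
  pos : ∀ x ∈ N, x ≠ 0 → 0 < φ x

/-- The cross section `Φ(N) = C(N) ∩ H`, where `H = {φ = 1}`. -/
def Phi (φ : E →ₗ[ℝ] ℝ) (N : AddSubmonoid E) : Set E :=
  {x | x ∈ cone (N : Set E) ∧ φ x = 1}

/-- The submonoid `N(W) = N ∩ ℝ₊ W`. -/
def sub (N : AddSubmonoid E) (W : Set E) : AddSubmonoid E :=
  N ⊓ (cone W).toAddSubmonoid

/-- `int(N) = N ∩ int(C(N))`, where `int(C(N))` is the relative interior. -/
def interiorPart (N : AddSubmonoid E) : Set E :=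
  {x | x ∈ N ∧ x ∈ intrinsicInterior ℝ (cone (N : Set E) : Set E)}

/-- `N_* = int(N) ∪ {0}`. -/
def interiorMonoid (N : AddSubmonoid E) : Set E := interiorPart N ∪ {0}

/-- `N^𝔠`, the union of the ascending chain of the monoids `N / (c₁ ⋯ c_j)`.
The sequence `c₁, c₂, …` is written `c 0, c 1, …`. -/
def divMonoid (c : ℕ → ℕ) (N : AddSubmonoid E) : AddSubmonoid E where
  carrier := {x | ∃ j : ℕ, (∏ i ∈ Finset.range j, c i) • x ∈ N}
  zero_mem' := ⟨0, by simp⟩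
  add_mem' := by
    have up : ∀ (x : E) (j k : ℕ), j ≤ k → (∏ i ∈ Finset.range j, c i) • x ∈ N →
        (∏ i ∈ Finset.range k, c i) • x ∈ N := by
      intro x j k hjk hx
      obtain ⟨d, hd⟩ := Finset.prod_dvd_prod_of_subset (Finset.range j) (Finset.range k) c
        (Finset.range_mono hjk)
      rw [hd, mul_comm, mul_smul]
      exact N.nsmul_mem hx d
    rintro x y ⟨j, hj⟩ ⟨k, hk⟩
    refine ⟨max j k, ?_⟩
    rw [smul_add]
    exact N.add_mem (up x j _ (le_max_left _ _) hj) (up y k _ (le_max_right _ _) hk)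

/-- The dimension of a convex set. -/
noncomputable def dim (P : Set E) : ℕ := Module.finrank ℝ (vectorSpan ℝ P)

/-- A nonempty convex polytope whose vertices are rational with respect to `gp(N)`. -/
def IsRationalPolytope (N : AddSubmonoid E) (P : Set E) : Prop :=
  ∃ S : Finset E, S.Nonempty ∧ (∀ x ∈ S, ∃ k : ℕ, 0 < k ∧ k • x ∈ gp N) ∧
    P = convexHull ℝ (S : Set E)

/-- `F` is a facet (a nonempty face of codimension 1) of the polytope `P`. -/
def IsFacet (F P : Set E) : Prop :=
  F.Nonempty ∧ IsExposed ℝ P F ∧ dim F + 1 = dim P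

/-- The polytope `δ` is a pyramid with base `B`: the convex hull of its facet `B` and a vertex
not in `B`. -/
def IsPyramid (δ B : Set E) : Prop :=
  IsFacet B δ ∧ ∃ v ∈ Set.extremePoints ℝ δ, v ∉ B ∧ δ = convexHull ℝ (insert v B)

/-- Pyramidal extensions `M ⊂ N`. -/
structure IsPyramidalExtension (φ : E →ₗ[ℝ] ℝ) (M N : AddSubmonoid E) : Prop where
  le : M ≤ N
  left : IsAffineNormal M
  right : IsAffineNormal N
  gp_eq : gp M = gp N
  pyramid : ∃ δ B : Set E, IsRationalPolytope N δ ∧ IsPyramid δ B ∧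
    Phi φ N = Phi φ M ∪ δ ∧ dim (Phi φ N) = dim (Phi φ M) ∧ dim (Phi φ N) = dim δ ∧
    Phi φ M ∩ δ = B

/-- Polarized monoids `(t, Γ, N)` with pole `t`. The polytope `Γ` is full dimensional in `Φ(N)`
(so that facets of `Γ` span hyperplanes) and `t ∉ ℝ₊ Γ` (so that `ℝ₊ t` is an edge of `C(N)`).
The isomorphism of `N ∩ (ℝ₊ t + ℝ₊ F)` with `ℤ₊ × N(F)` is the one induced by addition, `ℤ₊` being
identified with `ℤ₊ t`. -/
structure IsPolarized (φ : E →ₗ[ℝ] ℝ) (t : E) (Γ : Set E) (N : AddSubmonoid E) : Prop where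
  affineNormal : IsAffineNormal N
  crossSection : IsCrossSection φ N
  polytope : IsRationalPolytope N Γ
  subset : Γ ⊆ Phi φ N
  full_dim : dim Γ = dim (Phi φ N)
  pole_mem : t ∈ N
  pole_ne_zero : t ≠ 0
  pole_notMem : t ∉ cone Γ
  cone_eq : cone (N : Set E) = cone {t} ⊔ cone Γ
  facet : ∀ F, IsFacet F Γ →
    ∃ e : (ℕ × sub N F) ≃+ (N ⊓ (cone {t} ⊔ cone F).toAddSubmonoid : AddSubmonoid E),
      ∀ p, (e p : E) = p.1 • t + (p.2 : E)

end MonoidGeom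

open MonoidGeom

namespace MonoidGeom

open Filter Topology

variable {E : Type*} [NormedAddCommGroup E] [NormedSpace ℝ E]

/-! Put `Λ = gp N`. Both families in (c) can be taken to be increasing chains. The target monoids
are countable and the monoids to be built are finitely generated, so it suffices to capture finite
sets: given finite sets `X`, `Y` of nonzero elements of `N^𝔠_*` and `M^𝔠_*`, one nested polarized
system must have its smallest members containing `X` and `Y` (`exists_polarized_system`,
`exists_monotone_exhaustion`).

For the pole, pick a primitive lattice vector `τ` whose direction is so close to the apex `v` of the
pyramid that every `x ∈ X` is `a τ + m` with `a ≥ 0` and `m` interior to `C(M)`; also `τ` is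
interior to `C(N)` and outside `C(M)` (`exists_pole`). Separation and compactness of the sphere give
finitely many functionals, positive on `Y` and on the `m`'s, that cut out a cone inside `int C(M)`
with some room to spare. Adding `l δ φ` for `l = 1, …, s` makes the cones grow strictly with `l`,
and each functional is rescaled to take the value `±1` at `τ` (`exists_nested_functionals`).

The arithmetic is a simultaneous approximation. A real functional `f` with `f τ = ±1` has an
integral `g` with `g τ = ±Q` and `|g - Q f| ≤ D‖·‖`, where `D` does not depend on `Q`
(`exists_integral_approx`). Let `p` clear the denominators of `X` and `Y`, and put `t = τ/(pQ)`, `h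
= p g`, `Λ' = Λ/p + ℤ t`. Then `h` is integral on `Λ'` and `h t = ±1`, so `t` has lattice height one
over every facet; this is condition 2 of polarized monoids (`isPolarized_joinMonoid`).

For (b), the projection along `τ` kills `t`, so it sends `Λ'` into `Λ/p`. Hence lattice points off
the line of `τ` have norm at least `ρ/p`, with `ρ` independent of `p` and `Q`. On a nonzero lattice
point of the `l`-th cone, the next functionals are therefore at least `(Q η - D) ρ`, which exceeds
`1` for large `Q`, while `±t` changes them by only `1`. Taking `pQ` to be an initial product of the
sequence `𝔠` keeps `Λ'` inside the admissible denominators. -/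

theorem subset_cone (W : Set E) : W ⊆ cone W := Submodule.subset_span

theorem cone_le {W : Set E} {C : PointedCone ℝ E} : cone W ≤ C ↔ W ⊆ C := Submodule.span_le

theorem cone_mono {W W' : Set E} (h : W ⊆ W') : cone W ≤ cone W' := Submodule.span_mono h

theorem mem_cone_finset {S : Finset E} {x : E} :
    x ∈ cone (S : Set E) ↔ ∃ a : E → ℝ, (∀ s, 0 ≤ a s) ∧ ∑ s ∈ S, a s • s = x := by
  constructor
  · intro h
    obtain ⟨f, -, hf⟩ := Submodule.mem_span_finset.1 h
    exact ⟨fun s => f s, fun s => (f s).2, hf⟩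
  · rintro ⟨a, ha, rfl⟩
    exact Submodule.sum_mem _ fun s hs =>
      (cone _).smul_mem (ha s) (subset_cone _ hs)

theorem mem_cone_singleton {t x : E} : x ∈ cone ({t} : Set E) ↔ ∃ a : ℝ, 0 ≤ a ∧ a • t = x := by
  constructor
  · intro h
    obtain ⟨a, ha⟩ := Submodule.mem_span_singleton.1 h
    exact ⟨a, a.2, ha⟩
  · rintro ⟨a, ha, rfl⟩
    exact (cone _).smul_mem ha (subset_cone _ rfl)

theorem mem_cone_singleton_sup {t x : E} {C : PointedCone ℝ E} :
    x ∈ cone ({t} : Set E) ⊔ C ↔ ∃ a : ℝ, 0 ≤ a ∧ ∃ y ∈ C, a • t + y = x := by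
  rw [Submodule.mem_sup]
  constructor
  · rintro ⟨u, hu, y, hy, rfl⟩
    obtain ⟨a, ha, rfl⟩ := mem_cone_singleton.1 hu
    exact ⟨a, ha, y, hy, rfl⟩
  · rintro ⟨a, ha, y, hy, rfl⟩
    exact ⟨_, mem_cone_singleton.2 ⟨a, ha, rfl⟩, y, hy, rfl⟩

/-! ### Lattices, rational vectors and rational polytopes -/

/-- Gordan's lemma. -/
theorem fg_inf_cone [FiniteDimensional ℝ E] (Λ : AddSubgroup E) [DiscreteTopology Λ]
    (S : Finset E) (hS : ∀ s ∈ S, s ∈ Λ) :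
    (Λ.toAddSubmonoid ⊓ (cone (S : Set E)).toAddSubmonoid).FG := by
  classical
  set P := Λ.toAddSubmonoid ⊓ (cone (S : Set E)).toAddSubmonoid with hP
  set B : Set E := Metric.closedBall 0 (∑ s ∈ S, ‖s‖)
  have hfin : (B ∩ (Λ : Set E)).Finite := by
    have : ProperSpace E := FiniteDimensional.proper ℝ E
    have hd : DiscreteTopology (Λ : Set E) := ‹_›
    exact Metric.finite_isBounded_inter_isClosed hd.isDiscrete Metric.isBounded_closedBall
      Λ.isClosed_of_discrete
  refine AddSubmonoid.fg_iff _ |>.2 ⟨S ∪ (B ∩ Λ ∩ P), ?_,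
    S.finite_toSet.union (hfin.subset Set.inter_subset_left)⟩
  have hSP : ∀ s ∈ S, s ∈ P := fun s hs => ⟨hS s hs, subset_cone _ hs⟩
  apply le_antisymm
  · rw [AddSubmonoid.closure_le]
    rintro x (hx | hx)
    · exact hSP x hx
    · exact hx.2
  · intro x hx
    obtain ⟨a, ha, hax⟩ := mem_cone_finset.1 hx.2
    -- Split the coefficients into integer and fractional parts; the fractional part is one of
    -- finitely many lattice points of the ball.
    set y := ∑ s ∈ S, ⌊a s⌋₊ • s with hy
    set z := ∑ s ∈ S, (a s - ⌊a s⌋₊) • s with hz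
    have hxyz : y + z = x := by
      rw [hy, hz, ← Finset.sum_add_distrib, ← hax]
      refine Finset.sum_congr rfl fun s _ => ?_
      rw [← Nat.cast_smul_eq_nsmul ℝ, ← add_smul]; congr 1; ring
    have hyΛ : y ∈ Λ := Λ.sum_mem fun s hs => Λ.nsmul_mem (hS s hs) _
    have hzΛ : z ∈ Λ := by
      have : z = x - y := by rw [← hxyz]; abel
      rw [this]; exact Λ.sub_mem hx.1 hyΛ
    have hfr : ∀ s, 0 ≤ a s - ⌊a s⌋₊ := fun s => sub_nonneg.2 (Nat.floor_le (ha s))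
    have hzB : z ∈ B := by
      rw [mem_closedBall_zero_iff]
      refine (norm_sum_le _ _).trans (Finset.sum_le_sum fun s _ => ?_)
      rw [norm_smul, Real.norm_of_nonneg (hfr s)]
      have : a s - ⌊a s⌋₊ ≤ 1 := by linarith [Nat.lt_floor_add_one (a s)]
      exact mul_le_of_le_one_left (norm_nonneg _) this
    have hzP : z ∈ P := ⟨hzΛ, mem_cone_finset.2 ⟨_, hfr, rfl⟩⟩
    rw [← hxyz]
    refine add_mem (sum_mem fun s hs => nsmul_mem ?_ _) ?_
    · exact AddSubmonoid.subset_closure (Or.inl hs)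
    · exact AddSubmonoid.subset_closure (Or.inr ⟨⟨hzB, hzΛ⟩, hzP⟩)

theorem exists_lattice_basis [FiniteDimensional ℝ E] (Λ : AddSubgroup E) [DiscreteTopology Λ]
    (hΛ : Submodule.span ℝ (Λ : Set E) = ⊤) :
    ∃ (n : ℕ) (b : Module.Basis (Fin n) ℝ E), ∀ x, x ∈ Λ ↔ ∀ i, ∃ z : ℤ, b.repr x i = z := by
  let L : Submodule ℤ E := AddSubgroup.toIntSubmodule Λ
  have hd : DiscreteTopology L := ‹DiscreteTopology Λ›
  have hL : IsZLattice ℝ L := ⟨hΛ⟩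
  have : Module.Free ℤ L := ZLattice.module_free ℝ L
  have : Module.Finite ℤ L := ZLattice.module_finite ℝ L
  let b := (Module.finBasis ℤ L).ofZLatticeBasis ℝ L
  refine ⟨_, b, fun x => ?_⟩
  have hspan : Submodule.span ℤ (Set.range b) = L :=
    (Module.finBasis ℤ L).ofZLatticeBasis_span ℝ L
  have h := b.mem_span_iff_repr_mem ℤ x
  rw [hspan] at h
  exact h.trans (by simp [eq_comm])

theorem basis_mem {n : ℕ} {b : Module.Basis (Fin n) ℝ E} {Λ : AddSubgroup E}
    (hb : ∀ x, x ∈ Λ ↔ ∀ i, ∃ z : ℤ, b.repr x i = z) (i : Fin n) : b i ∈ Λ := by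
  refine (hb _).2 fun j => ?_
  rw [b.repr_self, Finsupp.single_apply]
  split_ifs
  · exact ⟨1, by simp⟩
  · exact ⟨0, by simp⟩

theorem exists_nsmul_mem_of_rational {n : ℕ} {b : Module.Basis (Fin n) ℝ E} {Λ : AddSubgroup E}
    (hb : ∀ x, x ∈ Λ ↔ ∀ i, ∃ z : ℤ, b.repr x i = z) {x : E}
    (hx : ∀ i, ∃ q : ℚ, b.repr x i = q) : ∃ k : ℕ, 0 < k ∧ k • x ∈ Λ := by
  choose q hq using hx
  refine ⟨∏ i, (q i).den, Finset.prod_pos fun i _ => Rat.den_pos _, (hb _).2 fun i => ?_⟩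
  obtain ⟨m, hm⟩ := Finset.dvd_prod_of_mem (fun i => (q i).den) (Finset.mem_univ i)
  refine ⟨m * (q i).num, ?_⟩
  have h : ((q i).den : ℝ) * (q i : ℝ) = ((q i).num : ℝ) := by
    exact_mod_cast Rat.den_mul_eq_num (q i)
  rw [hm, map_nsmul, Finsupp.smul_apply, hq, nsmul_eq_mul]
  push_cast
  rw [← h]; ring

/-- A retraction of `E` onto its rational vectors. -/
theorem exists_rational_retraction {n : ℕ} (b : Module.Basis (Fin n) ℝ E) (Λ : AddSubgroup E)
    (hb : ∀ x, x ∈ Λ ↔ ∀ i, ∃ z : ℤ, b.repr x i = z) :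
    ∃ (π : ℝ → ℚ) (P : E →+ E), π 1 = 1 ∧ π 0 = 0 ∧
      (∀ x, ∃ k : ℕ, 0 < k ∧ k • P x ∈ Λ) ∧
      (∀ y ∈ Λ, ∀ r : ℝ, P (r • y) = (π r : ℝ) • y) ∧
      ∀ h : E →ₗ[ℝ] ℝ, (∀ y ∈ Λ, ∃ q : ℚ, h y = q) → ∀ x, h (P x) = π (h x) := by
  -- A `ℚ`-linear retraction of `ℝ` onto `ℚ`, applied coordinatewise, preserves every rational
  -- linear equation.
  obtain ⟨π, hπ⟩ := LinearMap.exists_leftInverse_of_injective (Algebra.linearMap ℚ ℝ)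
    (LinearMap.ker_eq_bot.2 (algebraMap ℚ ℝ).injective)
  have hπq : ∀ q : ℚ, π q = q := fun q => by
    simpa using LinearMap.congr_fun hπ q
  have hπm : ∀ (r : ℝ) (q : ℚ), π (r * q) = π r * q := fun r q => by
    have : r * (q : ℝ) = q • r := by rw [Rat.smul_def, mul_comm]
    rw [this, map_smul, smul_eq_mul, mul_comm]
  have hbΛ : ∀ i, b i ∈ Λ := basis_mem hb
  let P : E →+ E :=
    { toFun := fun x => ∑ i, ((π (b.repr x i) : ℚ) : ℝ) • b i
      map_zero' := by simp
      map_add' := fun x y => by simp [add_smul, Finset.sum_add_distrib] }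
  have hP : ∀ x, P x = ∑ i, ((π (b.repr x i) : ℚ) : ℝ) • b i := fun x => rfl
  refine ⟨π, P, by simpa using hπq 1, map_zero π, fun x => ?_, fun y hy r => ?_, fun h hh x => ?_⟩
  · refine exists_nsmul_mem_of_rational hb fun i => ⟨π (b.repr x i), ?_⟩
    rw [hP, b.repr_sum_self]
  · rw [hP]
    conv_rhs => rw [← b.sum_repr y]
    rw [Finset.smul_sum]
    refine Finset.sum_congr rfl fun i _ => ?_
    obtain ⟨z, hz⟩ := (hb y).1 hy i
    rw [map_smul, Finsupp.smul_apply, smul_smul, hz, smul_eq_mul]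
    congr 1
    have := hπm r z
    push_cast at this
    rw [this]; push_cast; ring
  · rw [hP, map_sum]
    conv_rhs => rw [← b.sum_repr x, map_sum, map_sum]
    rw [Rat.cast_sum]
    refine Finset.sum_congr rfl fun i _ => ?_
    obtain ⟨q, hq⟩ := hh _ (hbΛ i)
    rw [map_smul, map_smul, hq, smul_eq_mul, smul_eq_mul, hπm, Rat.cast_mul]

/-- If `y ≠ x`, moving a little from `x` in both directions along `y - x` would violate no
inequality: active ones stay zero and inactive ones stay positive. So an extreme point is determined
by its active set, which makes extreme points finite in number and, below, rational. -/
theorem eq_of_extreme_of_active {κ : Type*} [Finite κ] {φ : E →ₗ[ℝ] ℝ} {h : κ → E →ₗ[ℝ] ℝ}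
    {x y : E} (hx : x ∈ Set.extremePoints ℝ {x | φ x = 1 ∧ ∀ i, 0 ≤ h i x})
    (hφ : φ y = 1) (hy : ∀ i, h i x = 0 → h i y = 0) : y = x := by
  obtain ⟨⟨hx1, hx2⟩, hext⟩ := hx
  have key : ∀ᶠ ε : ℝ in 𝓝 0, ∀ i, 0 ≤ h i (x + ε • (y - x)) := by
    refine eventually_all.2 fun i => ?_
    by_cases h0 : h i x = 0
    · refine Eventually.of_forall fun ε => ?_
      simp [h0, hy i h0]
    · have hpos : 0 < h i x := lt_of_le_of_ne (hx2 i) (Ne.symm h0)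
      have : Tendsto (fun ε : ℝ => h i x + ε * (h i y - h i x)) (𝓝 0) (𝓝 (h i x)) := by
        have : Continuous fun ε : ℝ => h i x + ε * (h i y - h i x) := by fun_prop
        simpa using this.tendsto 0
      filter_upwards [this.eventually (lt_mem_nhds hpos)] with ε hε
      simpa using hε.le
  have key' : ∀ᶠ ε : ℝ in 𝓝 0, ∀ i, 0 ≤ h i (x + (-ε) • (y - x)) := by
    have : Tendsto (fun ε : ℝ => -ε) (𝓝 0) (𝓝 0) := by simpa using (continuous_neg (G := ℝ)).tendsto 0
    exact this.eventually key
  obtain ⟨ε, ⟨h1, h2⟩, hε⟩ := (((key.and key').filter_mono nhdsWithin_le_nhds).and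
    (self_mem_nhdsWithin (a := (0 : ℝ)) (s := Set.Ioi 0))).exists
  have hε : 0 < ε := hε
  have := hext (x₁ := x + ε • (y - x)) ⟨by simp [hx1, hφ], h1⟩
    (x₂ := x + (-ε) • (y - x)) ⟨by simp [hx1, hφ], h2⟩
    ⟨1/2, 1/2, by norm_num, by norm_num, by norm_num, by module⟩
  have h3 : ε • (y - x) = 0 := by simpa using this
  rcases smul_eq_zero.1 h3 with h | h
  · exact absurd h hε.ne'
  · exact sub_eq_zero.1 h

/-- A bounded polyhedron defined by rational inequalities is a rational polytope. -/
theorem exists_finset_convexHull [FiniteDimensional ℝ E] {Λ : AddSubgroup E}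
    [DiscreteTopology Λ] (hΛ : Submodule.span ℝ (Λ : Set E) = ⊤)
    {κ : Type*} [Finite κ] {φ : E →ₗ[ℝ] ℝ} {h : κ → E →ₗ[ℝ] ℝ}
    (hφ : ∀ y ∈ Λ, ∃ q : ℚ, φ y = q) (hh : ∀ i, ∀ y ∈ Λ, ∃ q : ℚ, h i y = q)
    (hbd : Bornology.IsBounded {x | φ x = 1 ∧ ∀ i, 0 ≤ h i x}) :
    ∃ S : Finset E, (∀ x ∈ S, ∃ k : ℕ, 0 < k ∧ k • x ∈ Λ) ∧
      {x | φ x = 1 ∧ ∀ i, 0 ≤ h i x} = convexHull ℝ (S : Set E) := by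
  have : ProperSpace E := FiniteDimensional.proper ℝ E
  set Γ := {x | φ x = 1 ∧ ∀ i, 0 ≤ h i x} with hΓ
  have hc : IsCompact Γ := by
    refine Metric.isCompact_of_isClosed_isBounded ?_ hbd
    have h1 : IsClosed {x | φ x = 1} :=
      isClosed_eq φ.continuous_of_finiteDimensional continuous_const
    have h2 : IsClosed {x | ∀ i, 0 ≤ h i x} := by
      simp only [Set.ofPred_forall]
      exact isClosed_iInter fun i =>
        isClosed_le continuous_const (h i).continuous_of_finiteDimensional
    exact h1.inter h2
  have hconv : Convex ℝ Γ := by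
    rintro x ⟨hx1, hx2⟩ y ⟨hy1, hy2⟩ a b ha hb hab
    refine ⟨by simp [hx1, hy1, hab], fun i => ?_⟩
    have := mul_nonneg ha (hx2 i)
    have := mul_nonneg hb (hy2 i)
    simp only [map_add, map_smul, smul_eq_mul]; linarith
  have hfin : (Set.extremePoints ℝ Γ).Finite := by
    refine Set.Finite.of_finite_image (f := fun x => {i | h i x = 0}) (Set.toFinite _) ?_
    intro x hx y hy hxy
    exact (eq_of_extreme_of_active hx hy.1.1 fun i hi => (Set.ext_iff.1 hxy i).1 hi).symm
  refine ⟨hfin.toFinset, fun x hx => ?_, ?_⟩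
  · rw [Set.Finite.mem_toFinset] at hx
    obtain ⟨n, b, hb⟩ := exists_lattice_basis Λ hΛ
    obtain ⟨π, P, h1, h0, hP, -, hPh⟩ := exists_rational_retraction b Λ hb
    -- The rational retraction `P x` satisfies the same active equations as the vertex `x`, hence
    -- equals it.
    have hPx : P x = x := by
      refine eq_of_extreme_of_active hx ?_ fun i hi => ?_
      · rw [hPh φ hφ, hx.1.1, h1, Rat.cast_one]
      · rw [hPh _ (hh i), hi, h0, Rat.cast_zero]
    simpa [hPx] using hP x
  · have := closure_convexHull_extremePoints hc hconv
    rw [(hfin.isClosed_convexHull ℝ).closure_eq] at this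
    rw [Set.Finite.coe_toFinset, this]

/-! ### Polyhedral slices and the criterion for polarized monoids -/

/-- The slice `φ = 1` of the polyhedral cone `{x | ∀ i, 0 ≤ h i x}`. -/
def slice {κ : Type*} (φ : E →ₗ[ℝ] ℝ) (h : κ → E →ₗ[ℝ] ℝ) : Set E :=
  {x | φ x = 1 ∧ ∀ i, 0 ≤ h i x}

/-- The monoid of all points of `Λ` in the cone spanned by `t` and `Γ`. -/
def joinMonoid (Λ : AddSubgroup E) (t : E) (Γ : Set E) : AddSubmonoid E :=
  Λ.toAddSubmonoid ⊓ (cone {t} ⊔ cone Γ).toAddSubmonoid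

theorem mem_sub_joinMonoid {Λ : AddSubgroup E} {t x : E} {Γ : Set E} :
    x ∈ sub (joinMonoid Λ t Γ) Γ ↔ x ∈ Λ ∧ x ∈ cone Γ :=
  ⟨fun h => ⟨h.1.1, h.2⟩, fun h => ⟨⟨h.1, (le_sup_right : cone Γ ≤ cone {t} ⊔ cone Γ) h.2⟩, h.2⟩⟩

section slice

variable {κ : Type*} {φ : E →ₗ[ℝ] ℝ} {h : κ → E →ₗ[ℝ] ℝ}

theorem mem_cone_slice (hpos : ∀ x, x ≠ 0 → (∀ i, 0 ≤ h i x) → 0 < φ x) {x : E} :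
    x ∈ cone (slice φ h) ↔ ∀ i, 0 ≤ h i x := by
  constructor
  · intro hx i
    have : cone (slice φ h) ≤ (PointedCone.positive ℝ ℝ).comap (h i) :=
      cone_le.2 fun y hy => hy.2 i
    exact this hx
  · intro hx
    by_cases h0 : x = 0
    · rw [h0]; exact zero_mem _
    have hφ := hpos x h0 hx
    have : x = φ x • ((φ x)⁻¹ • x) := by rw [smul_smul, mul_inv_cancel₀ hφ.ne', one_smul]
    rw [this]
    refine (cone _).smul_mem hφ.le (subset_cone _ ⟨?_, fun i => ?_⟩)
    · simp [hφ.ne']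
    · rw [map_smul, smul_eq_mul]; exact mul_nonneg (inv_nonneg.2 hφ.le) (hx i)

variable [Finite κ]

theorem exists_pos_smul_add {p : E} (hp : ∀ i, 0 < h i p) (w : E) :
    ∃ ε : ℝ, 0 < ε ∧ ∀ i, 0 < h i (p + ε • w) := by
  have key : ∀ᶠ ε : ℝ in 𝓝 0, ∀ i, 0 < h i (p + ε • w) := by
    refine eventually_all.2 fun i => ?_
    have : Continuous fun ε : ℝ => h i p + ε * h i w := by fun_prop
    have : Tendsto (fun ε : ℝ => h i p + ε * h i w) (𝓝 0) (𝓝 (h i p)) := by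
      simpa using this.tendsto 0
    filter_upwards [this.eventually (lt_mem_nhds (hp i))] with ε hε
    simpa using hε
  obtain ⟨ε, h1, hε⟩ := ((key.filter_mono nhdsWithin_le_nhds).and
    (self_mem_nhdsWithin (a := (0 : ℝ)) (s := Set.Ioi 0))).exists
  exact ⟨ε, hε, h1⟩

/-- A facet of a polyhedron lies in the zero set of one of the defining inequalities. -/
theorem exists_eq_zero_of_isFacet {F : Set E} (hF : IsFacet F (slice φ h)) :
    ∃ i, ∀ x ∈ F, h i x = 0 := by
  classical
  obtain ⟨hne, hexp, hdim⟩ := hF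
  obtain ⟨l, hl⟩ := hexp hne
  have hFΓ : ∀ x ∈ F, x ∈ slice φ h := fun x hx => by rw [hl] at hx; exact hx.1
  have hFl : ∀ x ∈ F, ∀ y ∈ slice φ h, l y ≤ l x := fun x hx => by rw [hl] at hx; exact hx.2
  by_contra! hcon
  have : Fintype κ := Fintype.ofFinite κ
  -- If no inequality vanishes on all of `F`, averaging points of the face gives one where all
  -- inequalities are strict.
  have key : ∀ T : Finset κ, ∃ x ∈ F, ∀ i ∈ T, 0 < h i x := by
    intro T
    induction T using Finset.induction_on with
    | empty => exact ⟨hne.some, hne.some_mem, by simp⟩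
    | insert a T _ ih =>
      obtain ⟨x, hx, hxT⟩ := ih
      obtain ⟨y, hy, hya⟩ := hcon a
      have hx' := hFΓ x hx
      have hy' := hFΓ y hy
      refine ⟨(1/2 : ℝ) • x + (1/2 : ℝ) • y, ?_, fun i hi => ?_⟩
      · rw [hl]
        refine ⟨⟨?_, fun i => ?_⟩, fun z hz => ?_⟩
        · simp only [map_add, map_smul, smul_eq_mul, hx'.1, hy'.1]; norm_num
        · have := hx'.2 i
          have := hy'.2 i
          simp only [map_add, map_smul, smul_eq_mul]; linarith
        · have := hFl x hx z hz
          have := hFl y hy z hz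
          simp only [map_add, map_smul, smul_eq_mul]; linarith
      · have h1 := hx'.2 i
        have h2 := hy'.2 i
        simp only [map_add, map_smul, smul_eq_mul]
        rcases Finset.mem_insert.1 hi with rfl | hi
        · have := lt_of_le_of_ne h2 (Ne.symm hya)
          linarith
        · have := hxT i hi
          linarith
  obtain ⟨p, hpF, hp⟩ := key Finset.univ
  -- From such a point `p` one can move slightly away from any `x` of the slice; as `l` is maximal
  -- at `p`, this forces `l p ≤ l x`. The face is then everything, against its codimension.
  have hFeq : F = slice φ h := by
    refine Set.Subset.antisymm hFΓ fun x hx => ?_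
    obtain ⟨ε, hε, hεp⟩ := exists_pos_smul_add (fun i => hp i (Finset.mem_univ i)) (p - x)
    have h1 : l (p + ε • (p - x)) ≤ l p := by
      refine hFl p hpF _ ⟨?_, fun i => (hεp i).le⟩
      simp [(hFΓ p hpF).1, hx.1]
    have h2 : l p ≤ l x := by
      simp only [map_add, map_smul, map_sub, smul_eq_mul] at h1
      by_contra hlt
      have := mul_pos hε (sub_pos.2 (not_le.1 hlt))
      linarith
    rw [hl]
    exact ⟨hx, fun y hy => (hFl p hpF y hy).trans h2⟩
  rw [hFeq] at hdim
  omega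

/-- A point with all inequalities strict can be moved in every direction of `ker φ`, so the slice
already spans the directions of the whole hyperplane. -/
theorem dim_slice [FiniteDimensional ℝ E] {p : E} (hp : ∀ i, 0 < h i p) (hφp : φ p = 1) :
    ∀ T : Set E, slice φ h ⊆ T → (∀ x ∈ T, φ x = 1) → dim (slice φ h) = dim T := by
  intro T hT hTφ
  have h1 : vectorSpan ℝ T ≤ LinearMap.ker φ := by
    rw [vectorSpan_def, Submodule.span_le]
    rintro _ ⟨x, hx, y, hy, rfl⟩
    simp [hTφ x hx, hTφ y hy]
  have h2 : LinearMap.ker φ ≤ vectorSpan ℝ (slice φ h) := by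
    intro w hw
    obtain ⟨ε, hε, hεp⟩ := exists_pos_smul_add hp w
    have h3 : p + ε • w ∈ slice φ h := by
      refine ⟨?_, fun i => (hεp i).le⟩
      rw [LinearMap.mem_ker] at hw
      simp [hφp, hw]
    have h4 : p ∈ slice φ h := ⟨hφp, fun i => (hp i).le⟩
    have h5 := vsub_mem_vectorSpan ℝ h3 h4
    rw [vsub_eq_sub, add_sub_cancel_left] at h5
    exact (Submodule.smul_mem_iff _ hε.ne').1 h5
  unfold dim
  rw [le_antisymm (vectorSpan_mono ℝ hT) (h1.trans h2)]

/-- A polyhedral slice together with a pole at lattice height `±1` over each facet gives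
a polarized monoid. -/
theorem isPolarized_joinMonoid [FiniteDimensional ℝ E] {Λ : AddSubgroup E} [DiscreteTopology Λ]
    (hΛ : Submodule.span ℝ (Λ : Set E) = ⊤)
    (hφ : ∀ y ∈ Λ, ∃ q : ℚ, φ y = q) (hh : ∀ i, ∀ y ∈ Λ, ∃ z : ℤ, h i y = z)
    {t : E} (htΛ : t ∈ Λ) (ht : ∀ i, h i t = 1 ∨ h i t = -1) (hφt : 0 < φ t)
    (htK : ¬ ∀ i, 0 ≤ h i t) {m : E} (hm : ∀ i, 0 < h i m) (hm0 : m ≠ 0)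
    {C : ℝ} (hC : 0 < C) (hpos : ∀ x, (∀ i, 0 ≤ h i x) → C * ‖x‖ ≤ φ x) :
    IsPolarized φ t (slice φ h) (joinMonoid Λ t (slice φ h)) ∧
      cone (sub (joinMonoid Λ t (slice φ h)) (slice φ h) : Set E) = cone (slice φ h) ∧
      (sub (joinMonoid Λ t (slice φ h)) (slice φ h)).FG := by
  classical
  set Γ := slice φ h with hΓ
  set L := joinMonoid Λ t Γ with hL
  have hpos' : ∀ x, x ≠ 0 → (∀ i, 0 ≤ h i x) → 0 < φ x := fun x hx0 hx =>
    (mul_pos hC (norm_pos_iff.2 hx0)).trans_le (hpos x hx)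
  have hmem : ∀ {x}, x ∈ cone Γ ↔ ∀ i, 0 ≤ h i x := mem_cone_slice hpos'
  have hbd : Bornology.IsBounded Γ := by
    refine isBounded_iff_forall_norm_le.2 ⟨C⁻¹, fun x hx => ?_⟩
    have := hpos x hx.2
    rw [hx.1] at this
    rwa [← one_div, le_div_iff₀ hC, mul_comm]
  obtain ⟨S, hS, hSΓ⟩ := exists_finset_convexHull hΛ hφ
    (fun i y hy => (hh i y hy).elim fun z hz => ⟨(z : ℚ), by simpa using hz⟩) hbd
  have hSΓ : Γ = convexHull ℝ (S : Set E) := hSΓ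
  choose! k hk0 hkΛ using hS
  have hSsub : ∀ x ∈ S, x ∈ Γ := fun x hx => by rw [hSΓ]; exact subset_convexHull ℝ _ hx
  -- Multiples of the vertices lying in `Λ`; they span the same cone, so Gordan's lemma applies.
  set S' := S.image fun x => k x • x with hS'
  have hS'Λ : ∀ x ∈ S', x ∈ Λ := by
    intro x hx
    obtain ⟨y, hy, rfl⟩ := Finset.mem_image.1 hx
    exact hkΛ y hy
  have hconeS : cone (S' : Set E) = cone Γ := by
    apply le_antisymm
    · refine cone_le.2 fun x hx => ?_
      obtain ⟨y, hy, rfl⟩ := Finset.mem_image.1 (Finset.mem_coe.1 hx)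
      exact nsmul_mem (subset_cone _ (hSsub y hy)) _
    · refine cone_le.2 ?_
      rw [hSΓ]
      refine convexHull_min (fun x hx => ?_) (cone _).convex
      have h1 : k x • x ∈ cone (S' : Set E) :=
        subset_cone _ (Finset.mem_coe.2 (Finset.mem_image_of_mem _ hx))
      have h2 : x = ((k x : ℝ)⁻¹) • (k x • x) := by
        rw [← Nat.cast_smul_eq_nsmul ℝ, smul_smul, inv_mul_cancel₀, one_smul]
        exact Nat.cast_ne_zero.2 (hk0 x hx).ne'
      rw [h2]
      exact (cone _).smul_mem (by positivity) h1
  have hΓL : cone Γ ≤ cone (sub L Γ : Set E) := by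
    rw [← hconeS]
    refine cone_mono fun x hx => mem_sub_joinMonoid.2 ⟨hS'Λ x hx, ?_⟩
    rw [← hconeS]; exact subset_cone _ hx
  have hsubL : cone (sub L Γ : Set E) ≤ cone (L : Set E) := cone_mono fun x hx => hx.1
  have htL : t ∈ L := ⟨htΛ, (le_sup_left : cone {t} ≤ cone {t} ⊔ cone Γ) (subset_cone _ rfl)⟩
  have hgp : gp L ≤ Λ := by
    refine (AddSubgroup.closure_le _).2 fun x hx => ?_
    exact hx.1
  have ht0 : t ≠ 0 := by rintro rfl; simp at hφt
  have hφL : ∀ x ∈ cone {t} ⊔ cone Γ, x ≠ 0 → 0 < φ x := by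
    intro x hx hx0
    obtain ⟨a, ha, y, hy, rfl⟩ := mem_cone_singleton_sup.1 hx
    rw [map_add, map_smul, smul_eq_mul]
    by_cases hy0 : y = 0
    · subst hy0
      have : a ≠ 0 := by rintro rfl; simp at hx0
      have := mul_pos (lt_of_le_of_ne ha this.symm) hφt
      simpa using this
    · have := hpos' y hy0 (hmem.1 hy)
      have := mul_nonneg ha hφt.le
      linarith
  have hmφ := hpos' m hm0 fun i => (hm i).le
  set p := (φ m)⁻¹ • m with hp
  have hp1 : φ p = 1 := by simp [hp, hmφ.ne']
  have hph : ∀ i, 0 < h i p := fun i => by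
    rw [hp, map_smul, smul_eq_mul]; exact mul_pos (inv_pos.2 hmφ) (hm i)
  have hpΓ : p ∈ Γ := ⟨hp1, fun i => (hph i).le⟩
  have hSne : S.Nonempty := by
    rw [Finset.nonempty_iff_ne_empty]
    rintro rfl
    rw [hSΓ] at hpΓ; simp at hpΓ
  have hsubset : Γ ⊆ Phi φ L := fun x hx => ⟨hsubL (hΓL (subset_cone _ hx)), hx.1⟩
  refine ⟨⟨⟨?_, ?_, ?_, ?_⟩, ⟨?_, ?_⟩, ?_, hsubset, ?_, htL, ht0, ?_, ?_, ?_⟩, ?_, ?_⟩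
  · have h1 := fg_inf_cone Λ (insert t S') (by
      intro s hs
      rcases Finset.mem_insert.1 hs with rfl | hs
      · exact htΛ
      · exact hS'Λ s hs)
    have h2 : cone ((insert t S' : Finset E) : Set E) = cone {t} ⊔ cone Γ := by
      rw [← hconeS, Finset.coe_insert, Set.insert_eq]
      exact Submodule.span_union _ _
    rwa [h2] at h1
  · have hd : DiscreteTopology (Λ : Set E) := ‹_›
    exact hd.of_subset (s := (Λ : Set E)) (t := (gp L : Set E)) hgp
  · intro x hx k hk hkx
    refine ⟨hgp hx, ?_⟩
    have h2 : x = ((k : ℝ)⁻¹) • (k • x) := by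
      rw [← Nat.cast_smul_eq_nsmul ℝ, smul_smul, inv_mul_cancel₀, one_smul]
      exact Nat.cast_ne_zero.2 hk.ne'
    rw [h2]
    exact PointedCone.smul_mem _ (by positivity) hkx.2
  · intro x hx hnx
    by_contra h0
    have h1 := hφL x hx.2 h0
    have h2 := hφL (-x) hnx.2 (neg_ne_zero.2 h0)
    rw [map_neg] at h2; linarith
  · exact fun x hx => hφ x hx.1
  · exact fun x hx => hφL x hx.2
  · refine ⟨S, hSne, fun x hx => ⟨k x, hk0 x hx, AddSubgroup.subset_closure ⟨hkΛ x hx, ?_⟩⟩, hSΓ⟩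
    exact nsmul_mem ((le_sup_right : cone Γ ≤ cone {t} ⊔ cone Γ) (subset_cone _ (hSsub x hx))) _
  · exact dim_slice hph hp1 _ hsubset fun x hx => hx.2
  · exact fun hc => htK (hmem.1 hc)
  · apply le_antisymm
    · exact cone_le.2 fun x hx => hx.2
    · refine sup_le (cone_mono ?_) (hΓL.trans hsubL)
      rintro x rfl; exact htL
  · intro F hF
    obtain ⟨i, hi⟩ := exists_eq_zero_of_isFacet hF
    have hFΓ : F ⊆ Γ := hF.2.1.subset
    have hi' : ∀ x ∈ cone F, h i x = 0 := by
      intro x hx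
      have : cone F ≤ PointedCone.ofSubmodule (LinearMap.ker (h i)) :=
        cone_le.2 fun y hy => hi y hy
      exact this hx
    let f : (ℕ × sub L F) →+ (L ⊓ (cone {t} ⊔ cone F).toAddSubmonoid : AddSubmonoid E) :=
      { toFun := fun p => ⟨p.1 • t + p.2, add_mem (nsmul_mem htL _) p.2.2.1,
          add_mem (nsmul_mem ((le_sup_left : cone {t} ≤ cone {t} ⊔ cone F)
            (subset_cone _ rfl)) _) ((le_sup_right : cone F ≤ cone {t} ⊔ cone F) p.2.2.2)⟩
        map_zero' := by ext; simp
        map_add' := fun p q => by ext; simp [add_smul]; abel }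
    have hf : ∀ p, (f p : E) = p.1 • t + p.2 := fun p => rfl
    have hit : h i t ≠ 0 := by rcases ht i with h1 | h1 <;> rw [h1] <;> norm_num
    have hinj : Function.Injective f := by
      rintro ⟨a, x⟩ ⟨b, y⟩ hab
      have h1 : a • t + (x : E) = b • t + (y : E) := congrArg Subtype.val hab
      have h2 := congrArg (h i) h1
      simp only [map_add, map_nsmul, hi' _ x.2.2, hi' _ y.2.2, add_zero, nsmul_eq_mul] at h2
      have h3 : a = b := by exact_mod_cast mul_right_cancel₀ hit h2
      subst h3
      have h4 : x = y := Subtype.ext (add_left_cancel h1)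
      rw [h4]
    have hsurj : Function.Surjective f := by
      rintro ⟨x, hxL, hx⟩
      obtain ⟨a, ha, y, hy, rfl⟩ := mem_cone_singleton_sup.1 hx
      obtain ⟨z, hz⟩ := hh i _ hxL.1
      rw [map_add, hi' y hy, add_zero, map_smul, smul_eq_mul] at hz
      -- `h i` kills the facet and is `±1` at `t`, so up to sign the coefficient of `t` is the
      -- integer `h i x`.
      have h1 : ∃ z : ℤ, a = z := by
        rcases ht i with h1 | h1 <;> rw [h1] at hz
        · exact ⟨z, by simpa using hz⟩
        · exact ⟨-z, by push_cast; linarith⟩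
      obtain ⟨w, rfl⟩ := h1
      have hw : 0 ≤ w := by exact_mod_cast ha
      lift w to ℕ using hw
      have h2 : ((w : ℤ) : ℝ) • t = w • t := by
        rw [Int.cast_natCast, Nat.cast_smul_eq_nsmul]
      have hyΛ : y ∈ Λ := by
        have := Λ.sub_mem hxL.1 (Λ.nsmul_mem htΛ w)
        rwa [h2, add_sub_cancel_left] at this
      have hyL : y ∈ sub L F :=
        ⟨⟨hyΛ, (le_sup_right : cone Γ ≤ cone {t} ⊔ cone Γ) (cone_mono hFΓ hy)⟩, hy⟩
      refine ⟨(w, ⟨y, hyL⟩), Subtype.ext ?_⟩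
      rw [hf, ← h2]
    exact ⟨AddEquiv.ofBijective f ⟨hinj, hsurj⟩, hf⟩
  · exact le_antisymm (cone_le.2 fun x hx => hx.2) hΓL
  · have h1 := fg_inf_cone Λ S' hS'Λ
    rw [hconeS] at h1
    convert h1 using 1
    ext x
    exact mem_sub_joinMonoid

end slice

/-! ### Separation by finitely many functionals -/

/-- A point outside an open convex cone can be strictly separated from a finite subset of it. -/
theorem exists_functional_neg {U : Set E} (hUo : IsOpen U) (hUc : Convex ℝ U)
    (hUs : ∀ x ∈ U, ∀ r : ℝ, 0 < r → r • x ∈ U) (hUne : U.Nonempty) {Y : Finset E}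
    (hY : ∀ y ∈ Y, y ∈ U) {x : E} (hx : x ∉ U) (hx0 : x ≠ 0) :
    ∃ g : E →L[ℝ] ℝ, g x < 0 ∧ ∀ y ∈ Y, 0 < g y := by
  obtain ⟨f, hf⟩ := geometric_hahn_banach_open_point hUc hUo hx
  have hfs : ∀ a ∈ U, ∀ r : ℝ, 0 < r → r * f a < f x := fun a ha r hr => by
    simpa using hf _ (hUs a ha r hr)
  have hfx : 0 ≤ f x := by
    by_contra! hneg
    obtain ⟨a, ha⟩ := hUne
    have h1 := hf a ha
    have h2 := hfs a ha (f x / (2 * f a)) (div_pos_of_neg_of_neg hneg (by linarith))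
    have h3 : f x / (2 * f a) * f a = f x / 2 := by
      have : f a ≠ 0 := by linarith
      field_simp
    linarith
  have hfle : ∀ a ∈ U, f a ≤ 0 := by
    intro a ha
    by_contra! hpos
    have := hfs a ha ((f x + 1) / f a) (by positivity)
    rw [div_mul_cancel₀ _ hpos.ne'] at this
    linarith
  have hflt : ∀ a ∈ U, f a < 0 := by
    intro a ha
    refine lt_of_le_of_ne (hfle a ha) fun h0 => ?_
    have hfx' : 0 < f x := by rw [← h0]; exact hf a ha
    have hcont : Continuous fun ε : ℝ => a + ε • x := by fun_prop
    have hev : ∀ᶠ ε : ℝ in 𝓝 0, a + ε • x ∈ U :=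
      hcont.continuousAt.eventually_mem (hUo.mem_nhds (by simpa using ha))
    obtain ⟨ε, h1, hε⟩ := ((hev.filter_mono nhdsWithin_le_nhds).and
      (self_mem_nhdsWithin (a := (0 : ℝ)) (s := Set.Ioi 0))).exists
    have hε : 0 < ε := hε
    have := hfle _ h1
    simp only [map_add, map_smul, smul_eq_mul, h0, zero_add] at this
    have := mul_pos hε hfx'
    linarith
  -- So far `f < 0` on `U` and `0 ≤ f x`, with equality possible when `x` is on the boundary. A
  -- small tilt by a norming functional of `x` makes the sign at `x` strict and keeps it strict on
  -- the finite set `Y`.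
  obtain ⟨ψ, -, hψ⟩ := exists_dual_vector ℝ x (norm_ne_zero_iff.2 hx0)
  have hψx : 0 < ψ x := by rw [hψ]; simpa using hx0
  have hev : ∀ᶠ η : ℝ in 𝓝 0, ∀ y ∈ Y, 0 < -f y - η * ψ y := by
    refine (Finset.eventually_all Y).2 fun y hy => ?_
    have hcont : Continuous fun η : ℝ => -f y - η * ψ y := by fun_prop
    refine hcont.continuousAt.eventually (lt_mem_nhds ?_)
    simpa using hflt y (hY y hy)
  obtain ⟨η, h1, hη⟩ := ((hev.filter_mono nhdsWithin_le_nhds).and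
    (self_mem_nhdsWithin (a := (0 : ℝ)) (s := Set.Ioi 0))).exists
  have hη : 0 < η := hη
  refine ⟨-f - η • ψ, ?_, fun y hy => by simpa using h1 y hy⟩
  have := mul_pos hη hψx
  simp; linarith

/-- A finite subset of an open convex cone lies in the interior of a polyhedral cone all of whose
slight thickenings lie in the open cone. -/
theorem exists_finset_functional [FiniteDimensional ℝ E] {U : Set E} (hUo : IsOpen U)
    (hUc : Convex ℝ U) (hUs : ∀ x ∈ U, ∀ r : ℝ, 0 < r → r • x ∈ U) (hUne : U.Nonempty)
    {Y : Finset E} (hY : ∀ y ∈ Y, y ∈ U) :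
    ∃ (G : Finset (E →L[ℝ] ℝ)) (ε : ℝ), 0 < ε ∧ (∀ g ∈ G, ∀ y ∈ Y, 0 < g y) ∧
      ∀ x, x ≠ 0 → (∀ g ∈ G, -ε * ‖x‖ ≤ g x) → x ∈ U := by
  classical
  have : ProperSpace E := FiniteDimensional.proper ℝ E
  have key : ∃ (G : Finset (E →L[ℝ] ℝ)) (ε : ℝ), 0 < ε ∧ (∀ g ∈ G, ∀ y ∈ Y, 0 < g y) ∧
      ∀ x ∈ Metric.sphere (0 : E) 1 \ U, ∃ g ∈ G, g x < -ε := by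
    -- Each point outside `U` is cut off, with its neighbourhood and a margin, by one functional;
    -- compactness of the sphere minus `U` leaves finitely many and a common `ε`.
    refine ((isCompact_sphere (0 : E) 1).diff hUo).induction_on
      (p := fun s => ∃ (G : Finset (E →L[ℝ] ℝ)) (ε : ℝ), 0 < ε ∧ (∀ g ∈ G, ∀ y ∈ Y, 0 < g y) ∧
        ∀ x ∈ s, ∃ g ∈ G, g x < -ε) ⟨∅, 1, one_pos, by simp, by simp⟩ ?_ ?_ ?_
    · rintro s t hst ⟨G, ε, h1, h2, h3⟩
      exact ⟨G, ε, h1, h2, fun x hx => h3 x (hst hx)⟩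
    · rintro s t ⟨G, ε, h1, h2, h3⟩ ⟨G', ε', h1', h2', h3'⟩
      refine ⟨G ∪ G', min ε ε', lt_min h1 h1', fun g hg => ?_, ?_⟩
      · rcases Finset.mem_union.1 hg with hg | hg
        · exact h2 g hg
        · exact h2' g hg
      · rintro x (hx | hx)
        · obtain ⟨g, hg, hgx⟩ := h3 x hx
          exact ⟨g, Finset.mem_union_left _ hg, by linarith [min_le_left ε ε']⟩
        · obtain ⟨g, hg, hgx⟩ := h3' x hx
          exact ⟨g, Finset.mem_union_right _ hg, by linarith [min_le_right ε ε']⟩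
    · rintro x ⟨hx1, hxU⟩
      have hx0 : x ≠ 0 := by
        rintro rfl
        simp at hx1
      obtain ⟨g, hg, hgY⟩ := exists_functional_neg hUo hUc hUs hUne hY hxU hx0
      refine ⟨{z | g z < g x / 2}, mem_nhdsWithin_of_mem_nhds
        ((isOpen_lt g.continuous continuous_const).mem_nhds ?_), {g}, -(g x / 2), by linarith,
        by simpa using hgY, fun z hz => ⟨g, by simp, by simpa using hz⟩⟩
      change g x < g x / 2
      linarith
  obtain ⟨G, ε, hε, hG, hGx⟩ := key
  refine ⟨G, ε, hε, hG, fun x hx0 hx => ?_⟩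
  by_contra hxU
  have hn : 0 < ‖x‖ := norm_pos_iff.2 hx0
  have hu : ‖x‖⁻¹ • x ∉ U := fun h => hxU (by
    have := hUs _ h ‖x‖ hn
    rwa [smul_smul, mul_inv_cancel₀ hn.ne', one_smul] at this)
  obtain ⟨g, hg, hlt⟩ := hGx (‖x‖⁻¹ • x) ⟨by simp [norm_smul, hn.ne'], hu⟩
  rw [map_smul, smul_eq_mul, inv_mul_lt_iff₀ hn] at hlt
  have := hx g hg
  linarith

/-! ### Integral functionals and primitive vectors -/

section lattice

variable {n : ℕ} {b : Module.Basis (Fin n) ℝ E} {Λ : AddSubgroup E}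

/-- Approximation of real functionals by integral ones with a prescribed value at `τ`. -/
theorem exists_integral_approx [FiniteDimensional ℝ E]
    (hb : ∀ x, x ∈ Λ ↔ ∀ i, ∃ z : ℤ, b.repr x i = z)
    {τ : E} (hτ : τ ∈ Λ) {g₀ : E →ₗ[ℝ] ℝ} (hg₀ : ∀ y ∈ Λ, ∃ z : ℤ, g₀ y = z) (hg₀τ : g₀ τ = 1) :
    ∃ D : ℝ, 0 < D ∧ ∀ (f : E →ₗ[ℝ] ℝ) (σ : ℤ), f τ = σ → ∀ Q : ℕ, ∃ g : E →ₗ[ℝ] ℝ,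
      (∀ y ∈ Λ, ∃ z : ℤ, g y = z) ∧ g τ = σ * Q ∧ ∀ x, |g x - Q * f x| ≤ D * ‖x‖ := by
  -- Integral functionals vanishing at `τ`. Since `f - σ g₀` also vanishes at `τ`, it is a real
  -- combination of them; rounding `Q` times its coefficients leaves the value at `τ` untouched, and
  -- the error does not depend on `Q`.
  set β : Fin n → (E →ₗ[ℝ] ℝ) := fun i => b.coord i - (b.repr τ i) • g₀ with hβ
  have hβΛ : ∀ i, ∀ y ∈ Λ, ∃ z : ℤ, β i y = z := by
    intro i y hy
    obtain ⟨z1, h1⟩ := (hb y).1 hy i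
    obtain ⟨z2, h2⟩ := (hb τ).1 hτ i
    obtain ⟨z3, h3⟩ := hg₀ y hy
    exact ⟨z1 - z2 * z3, by simp [hβ, h1, h2, h3]⟩
  have hβτ : ∀ i, β i τ = 0 := fun i => by simp [hβ, hg₀τ]
  refine ⟨∑ i, ‖LinearMap.toContinuousLinearMap (β i)‖ + 1, by positivity, fun f σ hf Q => ?_⟩
  set r : Fin n → ℝ := fun i => f (b i) - σ * g₀ (b i) with hr
  have hsum : ∀ x, f x - σ * g₀ x = ∑ i, b.repr x i * r i := by
    intro x
    conv_lhs => rw [← b.sum_repr x, map_sum, map_sum, Finset.mul_sum, ← Finset.sum_sub_distrib]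
    refine Finset.sum_congr rfl fun i _ => ?_
    simp only [map_smul, smul_eq_mul, hr]; ring
  have hfx : ∀ x, f x = σ * g₀ x + ∑ i, r i * β i x := by
    intro x
    have h1 : ∑ i, r i * β i x = ∑ i, b.repr x i * r i - (∑ i, b.repr τ i * r i) * g₀ x := by
      rw [Finset.sum_mul, ← Finset.sum_sub_distrib]
      refine Finset.sum_congr rfl fun i _ => ?_
      simp [hβ]; ring
    rw [h1, ← hsum, ← hsum, hf, hg₀τ]; ring
  set g : E →ₗ[ℝ] ℝ := ((σ : ℝ) * Q) • g₀ + ∑ i, (round (Q * r i) : ℝ) • β i with hg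
  have hgx : ∀ x, g x = σ * Q * g₀ x + ∑ i, (round (Q * r i) : ℝ) * β i x := by
    intro x; simp [hg]
  refine ⟨g, fun y hy => ?_, ?_, fun x => ?_⟩
  · obtain ⟨z, hz⟩ := hg₀ y hy
    choose w hw using fun i => hβΛ i y hy
    refine ⟨σ * Q * z + ∑ i, round (Q * r i) * w i, ?_⟩
    rw [hgx, hz]; simp [hw]
  · rw [hgx]; simp [hβτ, hg₀τ]
  · have h1 : g x - Q * f x = ∑ i, (round (Q * r i) - Q * r i) * β i x := by
      rw [hgx, hfx, mul_add, Finset.mul_sum]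
      simp only [sub_mul, Finset.sum_sub_distrib]
      have : ∑ i, Q * (r i * β i x) = ∑ i, Q * r i * β i x :=
        Finset.sum_congr rfl fun i _ => by ring
      rw [this]; ring
    rw [h1]
    have h2 : |∑ i, (round (Q * r i) - Q * r i) * β i x|
        ≤ ∑ i, ‖LinearMap.toContinuousLinearMap (β i)‖ * ‖x‖ := by
      refine (Finset.abs_sum_le_sum_abs _ _).trans (Finset.sum_le_sum fun i _ => ?_)
      rw [abs_mul]
      have h3 : |(round (Q * r i) : ℝ) - Q * r i| ≤ 1 := by
        rw [abs_sub_comm]; linarith [abs_sub_round (Q * r i)]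
      have h4 : |β i x| ≤ ‖LinearMap.toContinuousLinearMap (β i)‖ * ‖x‖ :=
        (LinearMap.toContinuousLinearMap (β i)).le_opNorm x
      calc _ ≤ 1 * |β i x| := by gcongr
        _ ≤ _ := by rw [one_mul]; exact h4
    rw [add_mul, Finset.sum_mul]
    linarith [norm_nonneg x]

/-- Divide `w` by the gcd of its coordinates; a Bézout relation for that gcd is the functional `g₀`.
-/
theorem exists_primitive (hb : ∀ x, x ∈ Λ ↔ ∀ i, ∃ z : ℤ, b.repr x i = z) {w : E} (hw : w ∈ Λ)
    (hw0 : w ≠ 0) : ∃ τ ∈ Λ, (∃ r : ℝ, 0 < r ∧ τ = r • w) ∧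
      ∃ g₀ : E →ₗ[ℝ] ℝ, (∀ y ∈ Λ, ∃ z : ℤ, g₀ y = z) ∧ g₀ τ = 1 := by
  choose a ha using (hb w).1 hw
  obtain ⟨d, hd⟩ := (inferInstance : (Ideal.span (Set.range a)).IsPrincipal)
  have hd : Ideal.span (Set.range a) = Ideal.span {(d.natAbs : ℤ)} := by
    rw [hd, Int.span_natAbs]
  set m := d.natAbs with hm
  have hdvd : ∀ i, ∃ z : ℤ, a i = m * z := fun i => by
    have : a i ∈ Ideal.span (Set.range a) := Ideal.subset_span ⟨i, rfl⟩
    rw [hd, Ideal.mem_span_singleton] at this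
    exact this
  choose z hz using hdvd
  have hm0 : m ≠ 0 := by
    intro h0
    apply hw0
    rw [← b.sum_repr w]
    refine Finset.sum_eq_zero fun i _ => ?_
    rw [ha, hz, h0]; simp
  have hmR : (m : ℝ) ≠ 0 := Nat.cast_ne_zero.2 hm0
  have hmem : (m : ℤ) ∈ Ideal.span (Set.range a) := by
    rw [hd]; exact Ideal.mem_span_singleton_self _
  obtain ⟨u, hu⟩ := Ideal.mem_span_range_iff_exists_fun.1 hmem
  have hτ : ∀ i, b.repr ((m : ℝ)⁻¹ • w) i = z i := fun i => by
    rw [map_smul, Finsupp.smul_apply, ha, hz]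
    push_cast
    rw [smul_eq_mul, inv_mul_cancel_left₀ hmR]
  refine ⟨(m : ℝ)⁻¹ • w, (hb _).2 fun i => ⟨z i, hτ i⟩, ⟨_, by positivity, rfl⟩,
    ∑ i, (u i : ℝ) • b.coord i, fun y hy => ?_, ?_⟩
  · choose v hv using (hb y).1 hy
    exact ⟨∑ i, u i * v i, by simp [hv]⟩
  · rw [map_smul]
    have : (∑ i, (u i : ℝ) • b.coord i) w = m := by
      simp only [LinearMap.sum_apply, LinearMap.smul_apply, b.coord_apply, ha, smul_eq_mul]
      exact_mod_cast hu
    rw [this, smul_eq_mul, inv_mul_cancel₀ hmR]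

theorem exists_rational_mem_open [FiniteDimensional ℝ E]
    (hb : ∀ x, x ∈ Λ ↔ ∀ i, ∃ z : ℤ, b.repr x i = z) {W : Set E} (hW : IsOpen W)
    (hne : W.Nonempty) : ∃ w ∈ W, ∃ k : ℕ, 0 < k ∧ k • w ∈ Λ := by
  have hd : DenseRange fun q : Fin n → ℚ => b.equivFun.symm fun i => (q i : ℝ) := by
    have h1 : DenseRange fun (q : Fin n → ℚ) (i : Fin n) => (q i : ℝ) :=
      DenseRange.piMap fun _ => Rat.denseRange_cast
    have h2 : Continuous b.equivFun.symm :=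
      LinearMap.continuous_of_finiteDimensional (b.equivFun.symm : (Fin n → ℝ) →ₗ[ℝ] E)
    exact b.equivFun.symm.surjective.denseRange.comp h1 h2
  obtain ⟨q, hq⟩ := hd.exists_mem_open hW hne
  refine ⟨_, hq, exists_nsmul_mem_of_rational hb fun i => ⟨q i, ?_⟩⟩
  rw [← b.equivFun_apply, LinearEquiv.apply_symm_apply]

end lattice

/-! ### Interiors of cones and their rational points -/

theorem smul_mem_interior {C : PointedCone ℝ E} {x : E} (hx : x ∈ interior (C : Set E)) {r : ℝ}
    (hr : 0 < r) : r • x ∈ interior (C : Set E) := by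
  have hcont : Continuous fun y : E => r⁻¹ • y := by fun_prop
  have hsub : (fun y : E => r⁻¹ • y) ⁻¹' interior (C : Set E) ⊆ C := fun y hy => by
    have : r • r⁻¹ • y ∈ C := C.smul_mem hr.le (interior_subset hy)
    rwa [smul_smul, mul_inv_cancel₀ hr.ne', one_smul] at this
  refine interior_maximal hsub (isOpen_interior.preimage hcont) ?_
  change r⁻¹ • r • x ∈ interior (C : Set E)
  rwa [smul_smul, inv_mul_cancel₀ hr.ne', one_smul]

theorem add_mem_interior {C : PointedCone ℝ E} {x y : E} (hx : x ∈ C)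
    (hy : y ∈ interior (C : Set E)) : x + y ∈ interior (C : Set E) := by
  have hcont : Continuous fun z : E => z - x := by fun_prop
  have hsub : (fun z : E => z - x) ⁻¹' interior (C : Set E) ⊆ C := fun z hz => by
    have : x + (z - x) ∈ C := C.add_mem hx (interior_subset hz)
    rwa [add_sub_cancel] at this
  refine interior_maximal hsub (isOpen_interior.preimage hcont) ?_
  change x + y - x ∈ interior (C : Set E)
  rwa [add_sub_cancel_left]

theorem affineSpan_cone_eq_top {W : Set E} (hW : Submodule.span ℝ W = ⊤) :
    affineSpan ℝ (cone W : Set E) = ⊤ := by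
  have h1 : Submodule.span ℝ (cone W : Set E) = ⊤ :=
    top_le_iff.1 (hW ▸ Submodule.span_mono (subset_cone W))
  have h2 := affineSpan_insert_zero (k := ℝ) (cone W : Set E)
  rw [Set.insert_eq_of_mem (zero_mem (cone W)), h1] at h2
  rw [SetLike.ext'_iff, h2]; simp

theorem interior_cone_nonempty [FiniteDimensional ℝ E] {W : Set E}
    (hW : Submodule.span ℝ W = ⊤) : (interior (cone W : Set E)).Nonempty := by
  rw [(cone W).convex.interior_nonempty_iff_affineSpan_eq_top]
  exact affineSpan_cone_eq_top hW

theorem intrinsicInterior_eq_interior {s : Set E} (hs : affineSpan ℝ s = ⊤) :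
    intrinsicInterior ℝ s = interior s := by
  refine Set.Subset.antisymm ?_ interior_subset_intrinsicInterior
  rintro x ⟨y, hy, rfl⟩
  obtain ⟨t, ht, hto, hyt⟩ := mem_interior.1 hy
  obtain ⟨O, hO, rfl⟩ := isOpen_induced_iff.1 hto
  refine mem_interior.2 ⟨O, fun z hz => ?_, hO, hyt⟩
  have hz' : z ∈ affineSpan ℝ s := by rw [hs]; trivial
  exact ht (show (⟨z, hz'⟩ : affineSpan ℝ s) ∈ _ from hz)

/-- The affine span of the slice lies in the hyperplane `φ = 1`, so the open cone traces out a
neighbourhood of `x` within that span. -/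
theorem mem_intrinsicInterior_Phi {φ : E →ₗ[ℝ] ℝ} {M : AddSubmonoid E} {x : E}
    (hx : x ∈ interior (cone (M : Set E) : Set E)) (hφx : φ x = 1) :
    x ∈ intrinsicInterior ℝ (Phi φ M) := by
  have hxP : x ∈ Phi φ M := ⟨interior_subset hx, hφx⟩
  have hle : affineSpan ℝ (Phi φ M) ≤ AffineSubspace.mk' x (LinearMap.ker φ) := by
    refine affineSpan_le.2 fun y hy => ?_
    simp [AffineSubspace.mem_mk', hφx, hy.2]
  refine ⟨⟨x, subset_affineSpan ℝ _ hxP⟩, mem_interior.2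
    ⟨Subtype.val ⁻¹' interior (cone (M : Set E) : Set E), fun y hy => ⟨interior_subset hy, ?_⟩,
      isOpen_interior.preimage continuous_subtype_val, hx⟩, rfl⟩
  have := hle y.2
  rw [AffineSubspace.mem_mk', LinearMap.mem_ker, vsub_eq_sub, map_sub, hφx] at this
  linarith

theorem exists_pos_add_smul_mem {U : Set E} (hU : IsOpen U) {x : E} (hx : x ∈ U)
    (w : E) : ∃ ε : ℝ, 0 < ε ∧ x + ε • w ∈ U := by
  have hcont : Continuous fun ε : ℝ => x + ε • w := by fun_prop
  have hev : ∀ᶠ ε : ℝ in 𝓝 0, x + ε • w ∈ U :=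
    hcont.continuousAt.eventually_mem (hU.mem_nhds (by simpa using hx))
  obtain ⟨ε, h1, hε⟩ := ((hev.filter_mono nhdsWithin_le_nhds).and
    (self_mem_nhdsWithin (a := (0 : ℝ)) (s := Set.Ioi 0))).exists
  exact ⟨ε, hε, h1⟩

/-- The points with a positive multiple in `M`. -/
def rationalHull (M : AddSubmonoid E) : AddSubmonoid E where
  carrier := {x | ∃ k : ℕ, 0 < k ∧ k • x ∈ M}
  zero_mem' := ⟨1, one_pos, by simp⟩
  add_mem' := by
    rintro x y ⟨k, hk, hx⟩ ⟨l, hl, hy⟩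
    refine ⟨k * l, Nat.mul_pos hk hl, ?_⟩
    rw [smul_add]
    refine M.add_mem ?_ ?_
    · rw [mul_comm, mul_smul]; exact M.nsmul_mem hx l
    · rw [mul_smul]; exact M.nsmul_mem hy k

theorem smul_mem_rationalHull {M : AddSubmonoid E} {x : E} (hx : x ∈ rationalHull M) {q : ℚ}
    (hq : 0 ≤ q) : (q : ℝ) • x ∈ rationalHull M := by
  obtain ⟨k, hk, hx⟩ := hx
  refine ⟨q.den * k, Nat.mul_pos q.den_pos hk, ?_⟩
  have : (q.den * k) • (q : ℝ) • x = q.num.toNat • k • x := by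
    rw [← Nat.cast_smul_eq_nsmul ℝ, ← Nat.cast_smul_eq_nsmul ℝ q.num.toNat,
      ← Nat.cast_smul_eq_nsmul ℝ k, smul_smul, smul_smul]
    congr 1
    have h1 : ((q.num.toNat : ℤ) : ℝ) = (q.num : ℝ) := by
      rw [Int.toNat_of_nonneg (Rat.num_nonneg.2 hq)]
    have h2 : (q.den : ℝ) * (q : ℝ) = (q.num : ℝ) := by exact_mod_cast Rat.den_mul_eq_num q
    rw [Int.cast_natCast] at h1
    rw [h1, ← h2]; push_cast; ring
  rw [this]
  exact M.nsmul_mem hx _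

/-- The closure of the rational hull is stable under nonnegative real scalars, as these are limits
of nonnegative rationals; being a cone that contains `M`, it contains `cone M`. -/
theorem cone_subset_closure_rationalHull (M : AddSubmonoid E) :
    (cone (M : Set E) : Set E) ⊆ closure (rationalHull M : Set E) := by
  let C : PointedCone ℝ E :=
    { (rationalHull M).topologicalClosure with
      smul_mem' := by
        rintro ⟨r, hr⟩ x hx
        change r • x ∈ closure (rationalHull M : Set E)
        have hr' : r ∈ closure {a : ℝ | ∃ q : ℚ, 0 ≤ q ∧ a = q} := by
          refine mem_closure_of_tendsto ((tendsto_nat_floor_mul_div_atTop hr).comp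
            tendsto_natCast_atTop_atTop) (Eventually.of_forall fun k => ?_)
          exact ⟨(⌊r * (k : ℝ)⌋₊ : ℚ) / k, by positivity, by simp⟩
        refine map_mem_closure₂ (f := fun (a : ℝ) (y : E) => a • y) continuous_smul hr' hx ?_
        rintro a ⟨q, hq, rfl⟩ y hy
        exact smul_mem_rationalHull hy hq }
  have : cone (M : Set E) ≤ C := cone_le.2 fun x hx => subset_closure ⟨1, one_pos, by simpa using hx⟩
  exact this

theorem span_eq_top_of_gp {M : AddSubmonoid E} (h : Submodule.span ℝ (gp M : Set E) = ⊤) :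
    Submodule.span ℝ (M : Set E) = ⊤ := by
  refine top_le_iff.1 (h ▸ Submodule.span_le.2 ?_)
  have : gp M ≤ (Submodule.span ℝ (M : Set E)).toAddSubgroup :=
    (AddSubgroup.closure_le _).2 Submodule.subset_span
  exact this

/-- A rational point in the interior of the cone of `M` has a multiple in `M`. -/
theorem mem_rationalHull_of_mem_interior [FiniteDimensional ℝ E] {M : AddSubmonoid E}
    [DiscreteTopology (gp M)] (hM : Submodule.span ℝ (gp M : Set E) = ⊤) {x : E}
    (hx : ∃ k : ℕ, 0 < k ∧ k • x ∈ gp M) (hxU : x ∈ interior (cone (M : Set E) : Set E)) :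
    x ∈ rationalHull M := by
  obtain ⟨n, b, hb⟩ := exists_lattice_basis (gp M) hM
  obtain ⟨π, P, hπ, -, -, hP, -⟩ := exists_rational_retraction b (gp M) hb
  have hspan : ⊤ ≤ Submodule.span ℝ (M : Set E) := (span_eq_top_of_gp hM).ge
  set e := Module.Basis.ofSpan hspan with he
  have heM : ∀ i, e i ∈ M := fun i => Module.Basis.ofSpan_subset hspan ⟨i, rfl⟩
  have : Finite ((linearIndepOn_empty ℝ id).extend (Set.empty_subset (M : Set E))) :=
    Module.Finite.finite_basis e
  have : Fintype ((linearIndepOn_empty ℝ id).extend (Set.empty_subset (M : Set E))) :=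
    Fintype.ofFinite _
  -- Push `x` back inside the cone along a basis taken from `M` and approximate the result by `z` in
  -- the rational hull. Then `x - z` has positive coordinates in that basis, and these are rational
  -- because the retraction `P` fixes `x - z`.
  obtain ⟨ε, hε, hxε⟩ := exists_pos_add_smul_mem isOpen_interior hxU (-∑ i, e i)
  have hcl := cone_subset_closure_rationalHull M (interior_subset hxε)
  set W : Set E := {z | ∀ i, 0 < e.repr (x - z) i} with hW
  have hWo : IsOpen W := by
    rw [hW, Set.ofPred_forall]
    refine isOpen_iInter_of_finite fun i => isOpen_lt continuous_const ?_
    have h1 : Continuous (e.coord i) := LinearMap.continuous_of_finiteDimensional _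
    exact h1.comp (continuous_const.sub continuous_id)
  have hmem : x + ε • -∑ i, e i ∈ W := by
    intro i
    have : x - (x + ε • -∑ i, e i) = ∑ i, ε • e i := by
      rw [smul_neg, Finset.smul_sum]; abel
    rw [this, e.repr_sum_self (fun _ => ε)]
    exact hε
  obtain ⟨z, hzW, hz⟩ := mem_closure_iff.1 hcl W hWo hmem
  set y := x - z with hy
  have hMgp : ∀ w ∈ M, w ∈ gp M := fun w hw => AddSubgroup.subset_closure hw
  have hyrat : ∃ k : ℕ, 0 < k ∧ k • y ∈ gp M := by
    obtain ⟨k, hk, hkx⟩ := hx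
    obtain ⟨l, hl, hlz⟩ := hz
    refine ⟨k * l, Nat.mul_pos hk hl, ?_⟩
    rw [hy, smul_sub]
    refine (gp M).sub_mem ?_ ?_
    · rw [mul_comm, mul_smul]; exact (gp M).nsmul_mem hkx l
    · rw [mul_smul]; exact (gp M).nsmul_mem (hMgp _ hlz) k
  have hPy : P y = y := by
    obtain ⟨k, hk, hky⟩ := hyrat
    have h1 := hP _ hky 1
    rw [hπ, one_smul, Rat.cast_one, one_smul, map_nsmul] at h1
    rw [← Nat.cast_smul_eq_nsmul ℝ, ← Nat.cast_smul_eq_nsmul ℝ] at h1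
    exact smul_right_injective E (Nat.cast_ne_zero.2 hk.ne' : (k : ℝ) ≠ 0) h1
  have hPy' : P y = ∑ i, (π (e.repr y i) : ℝ) • e i := by
    conv_lhs => rw [← e.sum_repr y, map_sum]
    exact Finset.sum_congr rfl fun i _ => hP _ (hMgp _ (heM i)) _
  have hπy : ∀ i, (π (e.repr y i) : ℝ) = e.repr y i := fun i => by
    conv_rhs => rw [← hPy, hPy', e.repr_sum_self]
  have hyM : y ∈ rationalHull M := by
    rw [← hPy, hPy']
    refine sum_mem fun i _ => smul_mem_rationalHull ⟨1, one_pos, by simpa using heM i⟩ ?_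
    have := (hzW i).le
    rw [← hπy] at this
    exact_mod_cast this
  rw [← add_sub_cancel z x]
  exact add_mem hz hyM

/-! ### Finitely generated cones and the apex of the pyramid -/

theorem exists_finset_cone_eq {M : AddSubmonoid E} (hM : M.FG) :
    ∃ S : Finset E, (∀ x ∈ S, x ∈ M ∧ x ≠ 0) ∧ cone (M : Set E) = cone (S : Set E) := by
  classical
  obtain ⟨S, hS⟩ := hM
  have hSM : ∀ x ∈ S, x ∈ M := fun x hx => hS ▸ AddSubmonoid.subset_closure hx
  refine ⟨S.erase 0, fun x hx => ⟨hSM x (Finset.mem_of_mem_erase hx), Finset.ne_of_mem_erase hx⟩,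
    le_antisymm (cone_le.2 ?_) (cone_mono fun x hx => hSM x (Finset.mem_of_mem_erase hx))⟩
  have : M ≤ (cone ((S.erase 0 : Finset E) : Set E)).toAddSubmonoid := by
    rw [← hS, AddSubmonoid.closure_le]
    intro x hx
    by_cases h0 : x = 0
    · rw [h0]; exact zero_mem _
    · exact subset_cone _ (Finset.mem_coe.2 (Finset.mem_erase.2 ⟨h0, hx⟩))
  exact this

/-- It is enough to choose `C` on the finitely many nonzero generators: the triangle inequality
carries the bound to their nonnegative combinations. -/
theorem IsCrossSection.exists_norm_le {φ : E →ₗ[ℝ] ℝ} {N : AddSubmonoid E}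
    (hφ : IsCrossSection φ N) (hN : N.FG) :
    ∃ C : ℝ, 0 < C ∧ ∀ x ∈ cone (N : Set E), C * ‖x‖ ≤ φ x := by
  obtain ⟨S, hS, hSN⟩ := exists_finset_cone_eq hN
  have hev : ∀ᶠ C : ℝ in 𝓝 0, ∀ s ∈ S, C * ‖s‖ < φ s := by
    refine (Finset.eventually_all S).2 fun s hs => ?_
    have hcont : Continuous fun C : ℝ => C * ‖s‖ := by fun_prop
    refine hcont.continuousAt.eventually (gt_mem_nhds ?_)
    simpa using hφ.pos s (hS s hs).1 (hS s hs).2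
  obtain ⟨C, h1, hC⟩ := ((hev.filter_mono nhdsWithin_le_nhds).and
    (self_mem_nhdsWithin (a := (0 : ℝ)) (s := Set.Ioi 0))).exists
  have hC : 0 < C := hC
  refine ⟨C, hC, fun x hx => ?_⟩
  rw [hSN] at hx
  obtain ⟨a, ha, rfl⟩ := mem_cone_finset.1 hx
  rw [map_sum]
  refine (mul_le_mul_of_nonneg_left (norm_sum_le _ _) hC.le).trans ?_
  rw [Finset.mul_sum]
  refine Finset.sum_le_sum fun s hs => ?_
  rw [norm_smul, Real.norm_of_nonneg (ha s), map_smul, smul_eq_mul]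
  nlinarith [h1 s hs, ha s]

/-- The generators scaled to `φ = 1` have a closed convex hull, and a point with `φ > 0` can be in
the cone only if its normalisation lies in that hull. -/
theorem eventually_notMem_cone [FiniteDimensional ℝ E] {φ : E →ₗ[ℝ] ℝ} {M : AddSubmonoid E}
    (hM : M.FG) (hφ : ∀ x ∈ M, x ≠ 0 → 0 < φ x) {v : E} (hv : v ∉ cone (M : Set E))
    (hφv : φ v = 1) : ∀ᶠ w in 𝓝 v, w ∉ cone (M : Set E) := by
  classical
  obtain ⟨S, hS, hSM⟩ := exists_finset_cone_eq hM
  set K := convexHull ℝ ((fun s => (φ s)⁻¹ • s) '' (S : Set E)) with hK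
  have hKM : K ⊆ cone (M : Set E) := by
    refine convexHull_min ?_ (cone _).convex
    rintro _ ⟨s, hs, rfl⟩
    have := hφ s (hS s hs).1 (hS s hs).2
    exact (cone _).smul_mem (inv_nonneg.2 this.le) (subset_cone _ (hS s hs).1)
  have hmem : ∀ x ∈ cone (M : Set E), 0 < φ x → (φ x)⁻¹ • x ∈ K := by
    intro x hx hφx
    rw [hSM] at hx
    obtain ⟨a, ha, hax⟩ := mem_cone_finset.1 hx
    have h1 : (φ x)⁻¹ • x = ∑ s ∈ S, ((φ x)⁻¹ * a s * φ s) • ((φ s)⁻¹ • s) := by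
      conv_lhs => rw [← hax, Finset.smul_sum, hax]
      refine Finset.sum_congr rfl fun s hs => ?_
      have := hφ s (hS s hs).1 (hS s hs).2
      rw [smul_smul, smul_smul, mul_assoc _ (φ s), mul_inv_cancel₀ this.ne', mul_one]
    rw [h1]
    refine (convex_convexHull ℝ _).sum_mem (fun s hs => ?_) ?_ fun s hs =>
      subset_convexHull ℝ _ ⟨s, hs, rfl⟩
    · have := hφ s (hS s hs).1 (hS s hs).2
      have := ha s
      positivity
    · simp only [mul_assoc, ← Finset.mul_sum]
      have : φ x = ∑ s ∈ S, a s * φ s := by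
        conv_lhs => rw [← hax]
        simp
      rw [← this, inv_mul_cancel₀ hφx.ne']
  have hKc : IsClosed K := (S.finite_toSet.image _).isClosed_convexHull ℝ
  have hφc : Continuous φ := φ.continuous_of_finiteDimensional
  have hcont : ContinuousAt (fun w => (φ w)⁻¹ • w) v :=
    (hφc.continuousAt.inv₀ (by rw [hφv]; exact one_ne_zero)).smul continuousAt_id
  have hvK : (fun w => (φ w)⁻¹ • w) v ∈ Kᶜ := by
    simp only [hφv, inv_one, one_smul]
    exact fun h => hv (hKM h)
  have h2 : ∀ᶠ w in 𝓝 v, 0 < φ w := hφc.continuousAt.eventually (lt_mem_nhds (by simp [hφv]))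
  filter_upwards [hcont.eventually_mem (hKc.isOpen_compl.mem_nhds hvK), h2] with w hw1 hw2 hw3
  exact hw1 (hmem w hw3 hw2)

/-- The base of the pyramid lies in `Φ(M)`, so only the apex `v` is needed to generate `C(N)` over
`C(M)`. This is all that the construction uses of the pyramid. -/
theorem IsPyramidalExtension.exists_apex {φ : E →ₗ[ℝ] ℝ} {M N : AddSubmonoid E}
    (hφ : IsCrossSection φ N) (h : IsPyramidalExtension φ M N) :
    ∃ v ∈ cone (N : Set E), φ v = 1 ∧ v ∉ cone (M : Set E) ∧
      ∀ x ∈ cone (N : Set E), ∃ a : ℝ, 0 ≤ a ∧ ∃ m ∈ cone (M : Set E), a • v + m = x := by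
  obtain ⟨δ, B, -, ⟨-, v, hvδ, hvB, hδ⟩, hN, -, -, hB⟩ := h.pyramid
  have hvN : v ∈ Phi φ N := by rw [hN]; exact Or.inr hvδ.1
  refine ⟨v, hvN.1, hvN.2, fun hvM => hvB ?_, fun x hx => mem_cone_singleton_sup.1 ?_⟩
  · rw [← hB]; exact ⟨⟨hvM, hvN.2⟩, hvδ.1⟩
  · by_cases h0 : x = 0
    · rw [h0]; exact zero_mem _
    obtain ⟨C, hC, hCφ⟩ := hφ.exists_norm_le h.right.fg
    have hφx : 0 < φ x := (mul_pos hC (norm_pos_iff.2 h0)).trans_le (hCφ x hx)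
    have hx1 : (φ x)⁻¹ • x ∈ Phi φ N :=
      ⟨(cone _).smul_mem (inv_nonneg.2 hφx.le) hx, by simp [hφx.ne']⟩
    have hx2 : (φ x)⁻¹ • x ∈ cone {v} ⊔ cone (M : Set E) := by
      rw [hN] at hx1
      rcases hx1 with hx1 | hx1
      · exact (le_sup_right : cone (M : Set E) ≤ _) hx1.1
      · rw [hδ] at hx1
        refine convexHull_min ?_ (cone {v} ⊔ cone (M : Set E)).convex hx1
        rintro y (rfl | hy)
        · exact (le_sup_left : cone {y} ≤ cone {y} ⊔ cone (M : Set E)) (subset_cone _ rfl)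
        · rw [← hB] at hy
          exact (le_sup_right : cone (M : Set E) ≤ _) hy.1.1
    have := (cone {v} ⊔ cone (M : Set E)).smul_mem hφx.le hx2
    rwa [smul_smul, mul_inv_cancel₀ hφx.ne', one_smul] at this

/-! ### The refined lattice and lower bounds for norms -/

theorem exists_norm_le_of_discrete {E : Type*} [NormedAddCommGroup E]
    (Λ : AddSubgroup E) [DiscreteTopology Λ] :
    ∃ ρ : ℝ, 0 < ρ ∧ ∀ y ∈ Λ, y ≠ 0 → ρ ≤ ‖y‖ := by
  obtain ⟨ρ, hρ, h⟩ := Metric.isOpen_singleton_iff.1 (isOpen_discrete ({0} : Set Λ))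
  refine ⟨ρ, hρ, fun y hy hy0 => ?_⟩
  by_contra! hlt
  have := h ⟨y, hy⟩ (by simpa [Subtype.dist_eq] using hlt)
  exact hy0 (congrArg Subtype.val this)

section refinedLattice

/-- The lattice generated by `Λ / p` and `t`. -/
def refinedLattice {E : Type*} [AddCommGroup E] (Λ : AddSubgroup E) (p : ℕ) (t : E) : AddSubgroup E :=
  Λ.comap (nsmulAddMonoidHom p) ⊔ AddSubgroup.zmultiples t

variable {E : Type*} [NormedAddCommGroup E] {Λ : AddSubgroup E} {p q : ℕ} {t x : E}

theorem mem_refinedLattice : x ∈ refinedLattice Λ p t ↔ ∃ y, p • y ∈ Λ ∧ ∃ n : ℤ, y + n • t = x := by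
  unfold refinedLattice
  rw [AddSubgroup.mem_sup]
  simp [AddSubgroup.mem_zmultiples_iff]

theorem self_mem_refinedLattice : t ∈ refinedLattice Λ p t :=
  mem_refinedLattice.2 ⟨0, by simp, 1, by simp⟩

theorem mem_refinedLattice_of_nsmul_mem (h : p • x ∈ Λ) : x ∈ refinedLattice Λ p t :=
  mem_refinedLattice.2 ⟨x, h, 0, by simp⟩

theorem le_refinedLattice : Λ ≤ refinedLattice Λ p t := fun _ hx =>
  mem_refinedLattice_of_nsmul_mem (Λ.nsmul_mem hx p)

theorem nsmul_mem_of_mem_refinedLattice (ht : (p * q) • t ∈ Λ) (hx : x ∈ refinedLattice Λ p t) :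
    (p * q) • x ∈ Λ := by
  obtain ⟨y, hy, n, rfl⟩ := mem_refinedLattice.1 hx
  rw [smul_add, smul_comm]
  refine Λ.add_mem ?_ (Λ.zsmul_mem ht n)
  rw [mul_comm, mul_smul]
  exact Λ.nsmul_mem hy q

/-- Multiplication by `p q` maps the refined lattice into `Λ`, so nonzero vectors are at least `ρ /
(p q)` long. -/
theorem discreteTopology_refinedLattice [NormedSpace ℝ E] [DiscreteTopology Λ] (hpq : 0 < p * q)
    (ht : (p * q) • t ∈ Λ) :
    DiscreteTopology (refinedLattice Λ p t) := by
  obtain ⟨ρ, hρ, h⟩ := exists_norm_le_of_discrete Λ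
  have hpq' : (0 : ℝ) < (p * q : ℕ) := Nat.cast_pos.2 hpq
  refine discreteTopology_of_isOpen_singleton_zero
    (Metric.isOpen_singleton_iff.2 ⟨ρ / (p * q : ℕ), by positivity, ?_⟩)
  rintro ⟨x, hx⟩ hlt
  rw [Subtype.dist_eq, ZeroMemClass.coe_zero, dist_zero_right, lt_div_iff₀ hpq'] at hlt
  have h1 := nsmul_mem_of_mem_refinedLattice ht hx
  rw [← Nat.cast_smul_eq_nsmul ℝ] at h1
  by_contra hne
  have hx0 : x ≠ 0 := fun h0 => hne (Subtype.ext h0)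
  have h2 := h _ h1 (smul_ne_zero hpq'.ne' hx0)
  rw [norm_smul, Real.norm_of_nonneg hpq'.le, mul_comm] at h2
  linarith

end refinedLattice

/-- The bounded projection along `τ` lands in `Λ / p`, whose nonzero vectors have norm at least a
constant over `p`. As `ρ` does not depend on `p`, the approximation quality can be fixed before `p`
is known. -/
theorem exists_norm_le_of_projection [FiniteDimensional ℝ E] (Λ : AddSubgroup E)
    [DiscreteTopology Λ] (τ : E) (g₀ : E →ₗ[ℝ] ℝ) : ∃ ρ : ℝ, 0 < ρ ∧ ∀ (x : E) (p : ℕ), 0 < p →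
      p • (x - g₀ x • τ) ∈ Λ → x ≠ g₀ x • τ → ρ ≤ p * ‖x‖ := by
  obtain ⟨ρ, hρ, h⟩ := exists_norm_le_of_discrete Λ
  set A := 1 + ‖LinearMap.toContinuousLinearMap g₀‖ * ‖τ‖ with hA
  have hA0 : 0 < A := by positivity
  refine ⟨ρ / A, by positivity, fun x p hp hx hne => ?_⟩
  have hp' : (0 : ℝ) < p := Nat.cast_pos.2 hp
  have h1 := h _ hx (by
    rw [← Nat.cast_smul_eq_nsmul ℝ]
    exact smul_ne_zero hp'.ne' (sub_ne_zero.2 hne))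
  rw [← Nat.cast_smul_eq_nsmul ℝ, norm_smul, Real.norm_of_nonneg hp'.le] at h1
  have h2 : ‖x - g₀ x • τ‖ ≤ A * ‖x‖ := by
    have h3 : ‖g₀ x‖ ≤ ‖LinearMap.toContinuousLinearMap g₀‖ * ‖x‖ :=
      (LinearMap.toContinuousLinearMap g₀).le_opNorm x
    calc _ ≤ ‖x‖ + ‖g₀ x‖ * ‖τ‖ := by rw [← norm_smul]; exact norm_sub_le _ _
      _ ≤ ‖x‖ + ‖LinearMap.toContinuousLinearMap g₀‖ * ‖x‖ * ‖τ‖ := by gcongr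
      _ = _ := by rw [hA]; ring
  rw [div_le_iff₀ hA0]
  calc ρ ≤ p * ‖x - g₀ x • τ‖ := h1
    _ ≤ p * (A * ‖x‖) := by gcongr
    _ = _ := by ring

/-! ### The pole and the nested real cones -/

/-- The direction of a pole, close to the apex `v` of the pyramid. -/
theorem exists_pole [FiniteDimensional ℝ E] {n : ℕ} {b : Module.Basis (Fin n) ℝ E}
    {Λ : AddSubgroup E} (hb : ∀ x, x ∈ Λ ↔ ∀ i, ∃ z : ℤ, b.repr x i = z)
    {A B : PointedCone ℝ E} (hAB : A ≤ B) (hA : (interior (A : Set E)).Nonempty) {v : E}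
    (hvB : v ∈ B) (hvA : ∀ᶠ w in 𝓝 v, w ∉ A)
    (hdec : ∀ x ∈ B, ∃ a : ℝ, 0 ≤ a ∧ ∃ m ∈ A, a • v + m = x)
    {X : Finset E} (hX : ∀ x ∈ X, x ∈ interior (B : Set E)) :
    ∃ τ ∈ Λ, τ ∈ interior (B : Set E) ∧ τ ∉ A ∧
      (∃ g₀ : E →ₗ[ℝ] ℝ, (∀ y ∈ Λ, ∃ z : ℤ, g₀ y = z) ∧ g₀ τ = 1) ∧
      ∀ x ∈ X, ∃ a : ℝ, 0 ≤ a ∧ ∃ m ∈ interior (A : Set E), a • τ + m = x := by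
  obtain ⟨m₀, hm₀⟩ := hA
  have hev : ∀ᶠ w in 𝓝 v, ∀ x ∈ X, ∃ a : ℝ, 0 ≤ a ∧ ∃ m ∈ interior (A : Set E), a • w + m = x := by
    refine (Finset.eventually_all X).2 fun x hx => ?_
    -- Decomposing `x - ε m₀` instead of `x` puts the remainder in the interior of `A`, so it stays
    -- there when `v` is replaced by a nearby `w`.
    obtain ⟨ε, hε, hxε⟩ := exists_pos_add_smul_mem isOpen_interior (hX x hx) (-m₀)
    obtain ⟨a, ha, m, hm, hxm⟩ := hdec _ (interior_subset hxε)
    have h1 : x - a • v = m + ε • m₀ := by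
      have : x = a • v + m + ε • m₀ := by rw [hxm]; module
      rw [this]; abel
    have hcont : Continuous fun w : E => x - a • w := by fun_prop
    have h2 : ∀ᶠ w in 𝓝 v, x - a • w ∈ interior (A : Set E) :=
      hcont.continuousAt.eventually_mem (isOpen_interior.mem_nhds (by
        rw [h1]; exact add_mem_interior hm (smul_mem_interior hm₀ hε)))
    filter_upwards [h2] with w hw
    exact ⟨a, ha, _, hw, by abel⟩
  obtain ⟨O, hO, hOo, hvO⟩ := eventually_nhds_iff.1 (hvA.and hev)
  obtain ⟨ε, hε, hvε⟩ := exists_pos_add_smul_mem hOo hvO m₀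
  have hm₀B : m₀ ∈ interior (B : Set E) := interior_mono hAB hm₀
  obtain ⟨w, ⟨hwO, hwB⟩, k, hk, hkw⟩ := exists_rational_mem_open hb (hOo.inter isOpen_interior)
    ⟨_, hvε, add_mem_interior hvB (smul_mem_interior hm₀B hε)⟩
  obtain ⟨hwA, hwX⟩ := hO w hwO
  have hk' : (0 : ℝ) < k := Nat.cast_pos.2 hk
  have hw0 : w ≠ 0 := by rintro rfl; exact hwA (zero_mem A)
  rw [← Nat.cast_smul_eq_nsmul ℝ] at hkw
  obtain ⟨τ, hτ, ⟨r, hr, rfl⟩, hg⟩ := exists_primitive hb hkw (smul_ne_zero hk'.ne' hw0)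
  have hw : w = (r * k)⁻¹ • r • (k : ℝ) • w := by
    rw [smul_smul r, smul_smul, inv_mul_cancel₀ (by positivity), one_smul]
  refine ⟨_, hτ, smul_mem_interior (smul_mem_interior hwB hk') hr, fun h => hwA ?_, hg,
    fun x hx => ?_⟩
  · rw [hw]; exact A.smul_mem (by positivity) h
  · obtain ⟨a, ha, m, hm, rfl⟩ := hwX x hx
    refine ⟨a * (r * k)⁻¹, by positivity, m, hm, ?_⟩
    rw [mul_smul, ← hw]

/-- A nested family of polyhedral cones in an open cone, normalised at a given direction `τ`. -/
theorem exists_nested_functionals [FiniteDimensional ℝ E] {A : PointedCone ℝ E}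
    (hA : (interior (A : Set E)).Nonempty) {φ : E →ₗ[ℝ] ℝ} {C : ℝ} (hC : 0 < C)
    (hφ : ∀ x ∈ A, C * ‖x‖ ≤ φ x) {τ : E} (hτ : 0 < φ τ) {Y : Finset E}
    (hY : ∀ y ∈ Y, y ∈ interior (A : Set E)) (hY0 : ∀ y ∈ Y, y ≠ 0) (s : ℕ) :
    ∃ (G : Finset (E →L[ℝ] ℝ)) (f : G → ℕ → E →ₗ[ℝ] ℝ) (η : ℝ), 0 < η ∧
      (∀ i, ∀ l ∈ Set.Icc 1 s, f i l τ = 1 ∨ f i l τ = -1) ∧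
      (∀ i, ∀ l ∈ Set.Icc 1 s, ∀ y ∈ Y, 0 < f i l y) ∧
      (∀ l ∈ Set.Icc 1 s, ∀ x, x ≠ 0 → (∀ i, -η * ‖x‖ ≤ f i l x) → x ∈ interior (A : Set E)) ∧
      ∀ l ∈ Set.Ico 1 s, ∀ x, x ≠ 0 → (∀ i, -η * ‖x‖ ≤ f i l x) → ∀ i, η * ‖x‖ ≤ f i (l + 1) x := by
  classical
  obtain ⟨G, ε, hε, hGY, hGU⟩ := exists_finset_functional isOpen_interior A.convex.interior
    (fun x hx r hr => smul_mem_interior hx hr) hA hY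
  set B := ‖LinearMap.toContinuousLinearMap φ‖ + 1 with hB
  have hB0 : 0 < B := by positivity
  have hφB : ∀ x, φ x ≤ B * ‖x‖ := fun x => by
    have h1 : ‖φ x‖ ≤ ‖LinearMap.toContinuousLinearMap φ‖ * ‖x‖ :=
      (LinearMap.toContinuousLinearMap φ).le_opNorm x
    have := le_abs_self (φ x)
    rw [Real.norm_eq_abs] at h1
    rw [hB, add_mul, one_mul]
    linarith [norm_nonneg x]
  -- Only finitely many `δ` make some thickened functional vanish at `τ`, which would prevent its
  -- normalisation to `±1`.
  have hδ : ∃ δ : ℝ, 0 < δ ∧ s * δ * B ≤ ε / 2 ∧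
      ∀ g ∈ G, ∀ l ∈ Finset.Icc 1 s, g τ + l * δ * φ τ ≠ 0 := by
    have hpos : 0 < ε / (2 * (s + 1) * B) := by positivity
    have hfin : ((fun gl : (E →L[ℝ] ℝ) × ℕ => -gl.1 τ / (gl.2 * φ τ)) ''
      (G ×ˢ Finset.Icc 1 s : Finset _)).Finite := (Finset.finite_toSet _).image _
    obtain ⟨δ, ⟨h0, h1⟩, h2⟩ := ((Set.Ioo_infinite hpos).sdiff hfin).nonempty
    refine ⟨δ, h0, ?_, fun g hg l hl h3 => h2 ⟨(g, l), by simpa using ⟨hg, Finset.mem_Icc.1 hl⟩, ?_⟩⟩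
    · rw [lt_div_iff₀ (by positivity)] at h1
      nlinarith [mul_pos h0 hB0]
    · have hl0 : (0 : ℝ) < l := Nat.cast_pos.2 (Finset.mem_Icc.1 hl).1
      have : (l : ℝ) * φ τ ≠ 0 := by positivity
      change -g τ / (l * φ τ) = δ
      rw [div_eq_iff this]; linarith
  obtain ⟨δ, hδ0, hδε, hδne⟩ := hδ
  set μ : (E →L[ℝ] ℝ) → ℕ → ℝ := fun g l => |g τ + l * δ * φ τ| with hμ
  have hμ0 : ∀ g ∈ G, ∀ l ∈ Set.Icc 1 s, 0 < μ g l := fun g hg l hl =>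
    abs_pos.2 (hδne g hg l (Finset.mem_Icc.2 hl))
  set R := ∑ g ∈ G, |g τ| + s * δ * φ τ + 1 with hR
  have hR0 : 0 < R := by positivity
  have hμR : ∀ g ∈ G, ∀ l ∈ Set.Icc 1 s, μ g l ≤ R := by
    intro g hg l hl
    have h1 : |g τ| ≤ ∑ g ∈ G, |g τ| :=
      Finset.single_le_sum (f := fun g : E →L[ℝ] ℝ => |g τ|) (fun _ _ => abs_nonneg _) hg
    have h2 : |l * δ * φ τ| ≤ s * δ * φ τ := by
      rw [abs_of_nonneg (by positivity)]
      have : (l : ℝ) ≤ s := Nat.cast_le.2 hl.2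
      gcongr
    have := abs_add_le (g τ) (l * δ * φ τ)
    simp only [hμ, hR]; linarith
  -- `R` bounds all normalising factors. With `s δ B ≤ ε / 2`, the bound `R η ≤ ε / 2` keeps the
  -- thickened cones in `int A`. From `l` to `l + 1` one gains `δ φ x ≥ δ C ‖x‖`, and `2 R η ≤ δ C`
  -- lets this lift the lower bound from `-η` to `η`.
  set η := min (ε / 2) (δ * C / 2) / R with hη
  have hη0 : 0 < η := by positivity
  have hηR : R * η = min (ε / 2) (δ * C / 2) := by rw [hη]; field_simp
  have hη1 : R * η ≤ ε / 2 := hηR ▸ min_le_left _ _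
  have hη2 : R * η ≤ δ * C / 2 := hηR ▸ min_le_right _ _
  set f : G → ℕ → E →ₗ[ℝ] ℝ := fun g l => (μ g l)⁻¹ • ((g : E →L[ℝ] ℝ).toLinearMap + ((l : ℝ) * δ) • φ)
    with hf
  have hfx : ∀ (g : G) (l : ℕ) (x : E), f g l x = (μ g l)⁻¹ * ((g : E →L[ℝ] ℝ) x + l * δ * φ x) := by
    intro g l x; simp [hf]; ring
  have hlow : ∀ (g : G), ∀ l ∈ Set.Icc 1 s, ∀ x, -η * ‖x‖ ≤ f g l x →
      -(R * η) * ‖x‖ ≤ (g : E →L[ℝ] ℝ) x + l * δ * φ x := by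
    intro g l hl x hx
    rw [hfx, le_inv_mul_iff₀ (hμ0 g g.2 l hl)] at hx
    have := mul_le_mul_of_nonneg_right (hμR g g.2 l hl) (mul_nonneg hη0.le (norm_nonneg x))
    linarith
  have hmem : ∀ l ∈ Set.Icc 1 s, ∀ x, x ≠ 0 → (∀ i, -η * ‖x‖ ≤ f i l x) →
      x ∈ interior (A : Set E) := by
    intro l hl x hx0 hx
    refine hGU x hx0 fun g hg => ?_
    have h1 := hlow ⟨g, hg⟩ l hl x (hx _)
    have h2 : l * δ * φ x ≤ ε / 2 * ‖x‖ := by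
      calc l * δ * φ x ≤ l * δ * (B * ‖x‖) := by gcongr; exact hφB x
        _ ≤ s * δ * (B * ‖x‖) := by
          have : (l : ℝ) ≤ s := Nat.cast_le.2 hl.2
          gcongr
        _ = s * δ * B * ‖x‖ := by ring
        _ ≤ _ := by gcongr
    have h3 : R * η * ‖x‖ ≤ ε / 2 * ‖x‖ := by gcongr
    linarith
  refine ⟨G, f, η, hη0, fun g l hl => ?_, fun g l hl y hy => ?_, hmem, fun l hl x hx0 hx g => ?_⟩
  · rw [hfx]
    have h1 := hμ0 g g.2 l hl
    rcases abs_choice ((g : E →L[ℝ] ℝ) τ + l * δ * φ τ) with h2 | h2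
    · left
      have h3 : (g : E →L[ℝ] ℝ) τ + l * δ * φ τ = μ g l := h2.symm
      rw [h3, inv_mul_cancel₀ h1.ne']
    · right
      have h3 : (g : E →L[ℝ] ℝ) τ + l * δ * φ τ = -μ g l := by simp only [hμ]; rw [h2, neg_neg]
      rw [h3, mul_neg, inv_mul_cancel₀ h1.ne']
  · rw [hfx]
    have h1 := hμ0 g g.2 l hl
    have h2 := hGY g g.2 y hy
    have h3 : 0 < φ y :=
      (mul_pos hC (norm_pos_iff.2 (hY0 y hy))).trans_le (hφ y (interior_subset (hY y hy)))
    positivity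
  · have hl' : l ∈ Set.Icc 1 s := ⟨hl.1, hl.2.le⟩
    have hl1 : l + 1 ∈ Set.Icc 1 s := ⟨by omega, hl.2⟩
    have h1 := hlow g l hl' x (hx g)
    have h2 := hφ x (interior_subset (hmem l hl' x hx0 hx))
    have h3 := hμ0 g g.2 (l + 1) hl1
    have h4 := mul_le_mul_of_nonneg_left h2 hδ0.le
    have h5 : R * η * ‖x‖ ≤ δ * C / 2 * ‖x‖ := by gcongr
    have h6 : μ g (l + 1) * (η * ‖x‖) ≤ R * (η * ‖x‖) := by
      gcongr
      exact hμR g g.2 _ hl1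
    rw [hfx, le_inv_mul_iff₀ h3]
    push_cast
    linarith

/-! ### Denominators and the polarized system for finite sets -/

theorem prod_range_nsmul_mem {E : Type*} [AddCommGroup E] {Λ : AddSubgroup E} {c : ℕ → ℕ} {x : E}
    {j k : ℕ} (hjk : j ≤ k)
    (hx : (∏ i ∈ Finset.range j, c i) • x ∈ Λ) : (∏ i ∈ Finset.range k, c i) • x ∈ Λ := by
  obtain ⟨d, hd⟩ := Finset.prod_dvd_prod_of_subset (Finset.range j) (Finset.range k) c
    (Finset.range_mono hjk)
  rw [hd, mul_comm, mul_smul]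
  exact Λ.nsmul_mem hx d

theorem exists_common_denominator {E : Type*} [AddCommGroup E] {Λ : AddSubgroup E} {c : ℕ → ℕ}
    {X : Finset E}
    (hX : ∀ x ∈ X, ∃ j, (∏ i ∈ Finset.range j, c i) • x ∈ Λ) :
    ∃ j, ∀ x ∈ X, (∏ i ∈ Finset.range j, c i) • x ∈ Λ := by
  choose! J hJ using hX
  exact ⟨X.sup J, fun x hx => prod_range_nsmul_mem (Finset.le_sup hx) (hJ x hx)⟩

/-- Eventual bounds on the quality `Q` of the approximation. -/
theorem exists_forall_ge_approx {κ : Type*} [Finite κ] {f : κ → ℕ → E →ₗ[ℝ] ℝ} {s : ℕ}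
    {Y : Finset E} (hf : ∀ i, ∀ l ∈ Set.Icc 1 s, ∀ y ∈ Y, 0 < f i l y) {η : ℝ} (hη : 0 < η)
    {ρ : ℝ} (hρ : 0 < ρ) (D : ℝ) :
    ∃ Q₀ : ℕ, ∀ Q ≥ Q₀, D ≤ Q * η ∧ 1 < (Q * η - D) * ρ ∧
      ∀ i, ∀ l ∈ Set.Icc 1 s, ∀ y ∈ Y, D * ‖y‖ < Q * f i l y := by
  have hlin : ∀ a : ℝ, 0 < a → Tendsto (fun Q : ℕ => (Q : ℝ) * a) atTop atTop := fun a ha =>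
    tendsto_natCast_atTop_atTop.atTop_mul_const ha
  refine eventually_atTop.1 (((hlin η hη).eventually_ge_atTop D).and
    (Eventually.and ?_ (eventually_all.2 fun i => ?_)))
  · filter_upwards [(hlin (η * ρ) (by positivity)).eventually_gt_atTop (1 + D * ρ)] with Q hQ
    linarith
  · have : ∀ᶠ Q : ℕ in atTop, ∀ l ∈ Finset.Icc 1 s, ∀ y ∈ Y, D * ‖y‖ < Q * f i l y :=
      (Finset.eventually_all _).2 fun l hl => (Finset.eventually_all _).2 fun y hy =>
        (hlin _ (hf i l (Finset.mem_Icc.1 hl) y hy)).eventually_gt_atTop _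
    filter_upwards [this] with Q hQ l hl
    exact hQ l (Finset.mem_Icc.2 hl)

/-- For finite sets of points interior to the two cones there is a nested system of polarized
monoids with a common pole containing them. -/
theorem exists_polarized_system [FiniteDimensional ℝ E] {Λ : AddSubgroup E} [DiscreteTopology Λ]
    (hΛ : Submodule.span ℝ (Λ : Set E) = ⊤) {A B : PointedCone ℝ E} (hAB : A ≤ B)
    (hA : (interior (A : Set E)).Nonempty) {v : E} (hvB : v ∈ B) (hvA : ∀ᶠ w in 𝓝 v, w ∉ A)
    (hdec : ∀ x ∈ B, ∃ a : ℝ, 0 ≤ a ∧ ∃ m ∈ A, a • v + m = x)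
    {φ : E →ₗ[ℝ] ℝ} (hφ : ∀ y ∈ Λ, ∃ q : ℚ, φ y = q) {C : ℝ} (hC : 0 < C)
    (hφB : ∀ x ∈ B, C * ‖x‖ ≤ φ x) {c : ℕ → ℕ} (hc : ∀ i, 2 ≤ c i) {s : ℕ} (hs : 1 ≤ s)
    {X Y : Finset E} (hX : ∀ x ∈ X, x ∈ interior (B : Set E))
    (hXΛ : ∀ x ∈ X, ∃ j, (∏ i ∈ Finset.range j, c i) • x ∈ Λ)
    (hY : ∀ y ∈ Y, y ∈ interior (A : Set E))
    (hYΛ : ∀ y ∈ Y, ∃ j, (∏ i ∈ Finset.range j, c i) • y ∈ Λ) :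
    ∃ (t : E) (Γ : ℕ → Set E) (Λ' : AddSubgroup E),
      (∀ l ∈ Set.Icc 1 s, IsPolarized φ t (Γ l) (joinMonoid Λ' t (Γ l)) ∧
        cone (sub (joinMonoid Λ' t (Γ l)) (Γ l) : Set E) = cone (Γ l) ∧
        (sub (joinMonoid Λ' t (Γ l)) (Γ l)).FG) ∧
      (∀ x ∈ Λ', ∃ j, (∏ i ∈ Finset.range j, c i) • x ∈ Λ) ∧
      t ∈ interior (B : Set E) ∧
      (∀ l ∈ Set.Icc 1 s, ∀ x ∈ cone (Γ l), x ≠ 0 → x ∈ interior (A : Set E)) ∧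
      (∀ l ∈ Set.Ico 1 s, Γ l ⊆ Γ (l + 1)) ∧
      (∀ l ∈ Set.Ico 1 s, ∀ x ∈ Λ', x ∈ cone (Γ l) → x ≠ 0 → ∀ u, u = t ∨ u = -t →
        u + x ∈ Λ' ∧ u + x ∈ interior (cone (Γ (l + 1)) : Set E)) ∧
      (∀ x ∈ X, x ∈ joinMonoid Λ' t (Γ 1)) ∧
      ∀ y ∈ Y, y ∈ sub (joinMonoid Λ' t (Γ 1)) (Γ 1) := by
  classical
  obtain ⟨n, b, hb⟩ := exists_lattice_basis Λ hΛ
  obtain ⟨τ, hτΛ, hτB, hτA, ⟨g₀, hg₀, hg₀τ⟩, hτX⟩ := exists_pole hb hAB hA hvB hvA hdec hX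
  have hτ0 : τ ≠ 0 := by rintro rfl; exact hτA (zero_mem A)
  have hφpos : ∀ x ∈ B, x ≠ 0 → 0 < φ x := fun x hx hx0 =>
    (mul_pos hC (norm_pos_iff.2 hx0)).trans_le (hφB x hx)
  have hφτ := hφpos τ (interior_subset hτB) hτ0
  have h0A : (0 : E) ∉ interior (A : Set E) := by
    intro h0
    obtain ⟨ε, hε, h1⟩ := exists_pos_add_smul_mem isOpen_interior h0 (-τ)
    have h2 := hφB _ (hAB (interior_subset h1))
    have h3 : 0 ≤ C * ‖0 + ε • -τ‖ := by positivity
    have h4 := mul_pos hε hφτ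
    simp only [zero_add, map_smul, map_neg, smul_eq_mul] at h2 h3
    linarith
  choose! a ha m hm hXm using hτX
  obtain ⟨m₀, hm₀⟩ := hA
  -- The cones must contain `Y` and the remainders of `X`; `m₀` ensures an interior point even when
  -- both sets are empty.
  set Y' := insert m₀ (Y ∪ X.image m) with hY'
  have hY'A : ∀ y ∈ Y', y ∈ interior (A : Set E) := by
    intro y hy
    rcases Finset.mem_insert.1 hy with rfl | hy
    · exact hm₀
    rcases Finset.mem_union.1 hy with hy | hy
    · exact hY y hy
    · obtain ⟨x, hx, rfl⟩ := Finset.mem_image.1 hy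
      exact hm x hx
  obtain ⟨G, f, η, hη, hfτ, hfY, hfA, hfstep⟩ := exists_nested_functionals ⟨m₀, hm₀⟩ hC
    (fun x hx => hφB x (hAB hx)) hφτ hY'A (fun y hy h0 => h0A (h0 ▸ hY'A y hy)) s
  obtain ⟨D, hD, happrox⟩ := exists_integral_approx hb hτΛ hg₀ hg₀τ
  obtain ⟨ρ, hρ, hρx⟩ := exists_norm_le_of_projection Λ τ g₀
  obtain ⟨Q₀, hQ₀⟩ := exists_forall_ge_approx hfY hη hρ D
  obtain ⟨j, hj⟩ := exists_common_denominator (X := X ∪ Y) (c := c) (Λ := Λ) fun x hx => by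
    rcases Finset.mem_union.1 hx with hx | hx
    · exact hXΛ x hx
    · exact hYΛ x hx
  set p := ∏ i ∈ Finset.range j, c i with hp
  set Q := ∏ i ∈ Finset.range Q₀, c (j + i) with hQ
  have hp0 : 0 < p := Finset.prod_pos fun i _ => by linarith [hc i]
  have hQge : Q₀ ≤ Q := by
    have : 2 ^ Q₀ ≤ Q := by
      have := Finset.prod_le_prod' (s := Finset.range Q₀) fun i _ => hc (j + i)
      simpa using this
    exact Nat.lt_two_pow_self.le.trans this
  have hQ0 : 0 < Q := Finset.prod_pos fun i _ => by linarith [hc (j + i)]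
  have hpQ : p * Q = ∏ i ∈ Finset.range (j + Q₀), c i := (Finset.prod_range_add _ _ _).symm
  obtain ⟨hDQ, hρQ, hQY⟩ := hQ₀ Q hQge
  have hpR : (0 : ℝ) < p := Nat.cast_pos.2 hp0
  have hQR : (0 : ℝ) < Q := Nat.cast_pos.2 hQ0
  have hσ : ∀ i : G, ∀ l, ∃ σ : ℤ, l ∈ Set.Icc 1 s → (σ = 1 ∨ σ = -1) ∧ f i l τ = σ := by
    intro i l
    by_cases hl : l ∈ Set.Icc 1 s
    · rcases hfτ i l hl with h | h
      · exact ⟨1, fun _ => ⟨Or.inl rfl, by simpa using h⟩⟩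
      · exact ⟨-1, fun _ => ⟨Or.inr rfl, by simpa using h⟩⟩
    · exact ⟨0, fun h => absurd h hl⟩
  choose σ hσ using hσ
  have hg : ∀ i : G, ∀ l, ∃ g : E →ₗ[ℝ] ℝ, l ∈ Set.Icc 1 s → (∀ y ∈ Λ, ∃ z : ℤ, g y = z) ∧
      g τ = σ i l * Q ∧ ∀ x, |g x - Q * f i l x| ≤ D * ‖x‖ := by
    intro i l
    by_cases hl : l ∈ Set.Icc 1 s
    · obtain ⟨g, hg⟩ := happrox _ _ (hσ i l hl).2 Q
      exact ⟨g, fun _ => hg⟩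
    · exact ⟨0, fun h => absurd h hl⟩
  choose g hg using hg
  set h : ℕ → G → E →ₗ[ℝ] ℝ := fun l i => (p : ℝ) • g i l with hh
  have hhx : ∀ l i x, h l i x = p * g i l x := fun l i x => rfl
  set t : E := ((p * Q : ℕ) : ℝ)⁻¹ • τ with ht
  have hpQR : (0 : ℝ) < (p * Q : ℕ) := Nat.cast_pos.2 (Nat.mul_pos hp0 hQ0)
  have htτ : (p * Q) • t = τ := by
    rw [← Nat.cast_smul_eq_nsmul ℝ, ht, smul_smul, mul_inv_cancel₀ hpQR.ne', one_smul]
  have htΛ : (p * Q) • t ∈ Λ := by rw [htτ]; exact hτΛ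
  set Λ' := refinedLattice Λ p t with hΛ'
  have hd : DiscreteTopology Λ' := discreteTopology_refinedLattice (Nat.mul_pos hp0 hQ0) htΛ
  have hspan : Submodule.span ℝ (Λ' : Set E) = ⊤ :=
    top_le_iff.1 (hΛ ▸ Submodule.span_mono le_refinedLattice)
  have htB : t ∈ interior (B : Set E) := smul_mem_interior hτB (inv_pos.2 hpQR)
  have hφt : 0 < φ t := by
    rw [ht, map_smul, smul_eq_mul]; exact mul_pos (inv_pos.2 hpQR) hφτ
  have htA : t ∉ A := fun hc => hτA (htτ ▸ nsmul_mem hc _)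
  have hφΛ' : ∀ y ∈ Λ', ∃ q : ℚ, φ y = q := by
    intro y hy
    obtain ⟨q, hq⟩ := hφ _ (nsmul_mem_of_mem_refinedLattice htΛ hy)
    refine ⟨q / (p * Q : ℕ), ?_⟩
    rw [map_nsmul, nsmul_eq_mul] at hq
    rw [Rat.cast_div, Rat.cast_natCast, ← hq, mul_div_cancel_left₀ _ hpQR.ne']
  have hht : ∀ l ∈ Set.Icc 1 s, ∀ i, h l i t = σ i l := by
    intro l hl i
    rw [hhx, ht, map_smul, (hg i l hl).2.1, smul_eq_mul]
    push_cast
    field_simp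
  have hht' : ∀ l ∈ Set.Icc 1 s, ∀ i, h l i t = 1 ∨ h l i t = -1 := by
    intro l hl i
    rw [hht l hl]
    rcases (hσ i l hl).1 with h1 | h1 <;> simp [h1]
  have hhΛ' : ∀ l ∈ Set.Icc 1 s, ∀ i, ∀ y ∈ Λ', ∃ z : ℤ, h l i y = z := by
    intro l hl i y hy
    obtain ⟨w, hw, k, rfl⟩ := mem_refinedLattice.1 hy
    obtain ⟨z, hz⟩ := (hg i l hl).1 _ hw
    rw [map_nsmul, nsmul_eq_mul] at hz
    refine ⟨z + k * σ i l, ?_⟩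
    rw [map_add, map_zsmul, hht l hl, hhx, hz]
    simp
  -- As `D ≤ Q η`, the approximation error is absorbed by the tolerance `η` of the real cones.
  have hlow : ∀ l ∈ Set.Icc 1 s, ∀ x, (∀ i, 0 ≤ h l i x) → ∀ i, -η * ‖x‖ ≤ f i l x := by
    intro l hl x hx i
    have h1 := (abs_le.1 ((hg i l hl).2.2 x)).2
    have h2 : 0 ≤ g i l x := by
      have := hx i
      rw [hhx] at this
      exact nonneg_of_mul_nonneg_right this hpR
    have h3 : D * ‖x‖ ≤ Q * η * ‖x‖ := by gcongr
    have h4 : 0 ≤ Q * (f i l x + η * ‖x‖) := by linarith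
    linarith [nonneg_of_mul_nonneg_right h4 hQR]
  have hmemA : ∀ l ∈ Set.Icc 1 s, ∀ x, x ≠ 0 → (∀ i, 0 ≤ h l i x) → x ∈ interior (A : Set E) :=
    fun l hl x hx0 hx => hfA l hl x hx0 (hlow l hl x hx)
  have hφh : ∀ l ∈ Set.Icc 1 s, ∀ x, (∀ i, 0 ≤ h l i x) → C * ‖x‖ ≤ φ x := by
    intro l hl x hx
    by_cases hx0 : x = 0
    · simp [hx0]
    · exact hφB x (hAB (interior_subset (hmemA l hl x hx0 hx)))
  have hφh' : ∀ l ∈ Set.Icc 1 s, ∀ x, x ≠ 0 → (∀ i, 0 ≤ h l i x) → 0 < φ x := fun l hl x hx0 hx =>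
    hφpos x (hAB (interior_subset (hmemA l hl x hx0 hx))) hx0
  have hcone : ∀ l ∈ Set.Icc 1 s, ∀ x, x ∈ cone (slice φ (h l)) ↔ ∀ i, 0 ≤ h l i x :=
    fun l hl x => mem_cone_slice (hφh' l hl)
  have hstep : ∀ l ∈ Set.Ico 1 s, ∀ x, x ≠ 0 → (∀ i, 0 ≤ h l i x) →
      ∀ i, p * ((Q * η - D) * ‖x‖) ≤ h (l + 1) i x := by
    intro l hl x hx0 hx i
    have hl1 : l + 1 ∈ Set.Icc 1 s := ⟨by omega, hl.2⟩
    have h1 := hfstep l hl x hx0 (hlow l ⟨hl.1, hl.2.le⟩ x hx) i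
    have h2 := (abs_le.1 ((hg i (l + 1) hl1).2.2 x)).1
    have h3 := mul_le_mul_of_nonneg_left h1 hQR.le
    rw [hhx]
    refine mul_le_mul_of_nonneg_left ?_ hpR.le
    linarith
  have hYh : ∀ l ∈ Set.Icc 1 s, ∀ y ∈ Y', ∀ i, 0 < h l i y := by
    intro l hl y hy i
    have h1 := hQY i l hl y hy
    have h2 := (abs_le.1 ((hg i l hl).2.2 y)).1
    rw [hhx]
    exact mul_pos hpR (by linarith)
  have h1s : 1 ∈ Set.Icc 1 s := ⟨le_rfl, hs⟩
  have hY'1 : ∀ y ∈ Y', y ∈ cone (slice φ (h 1)) := fun y hy =>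
    (hcone 1 h1s y).2 fun i => (hYh 1 h1s y hy i).le
  refine ⟨t, fun l => slice φ (h l), Λ', fun l hl => ?_, fun x hx => ⟨j + Q₀, ?_⟩, htB,
    fun l hl x hx hx0 => hmemA l hl x hx0 ((hcone l hl x).1 hx), fun l hl x hx => ⟨hx.1, fun i => ?_⟩,
    fun l hl x hxΛ hx hx0 u hu => ⟨?_, ?_⟩, fun x hx => ⟨?_, ?_⟩, fun y hy => ?_⟩
  · exact isPolarized_joinMonoid hspan hφΛ' (hhΛ' l hl) self_mem_refinedLattice (hht' l hl) hφt
      (fun hc => htA (interior_subset (hmemA l hl t (by rintro h0; simp [h0] at hφt) hc)))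
      (hYh l hl m₀ (Finset.mem_insert_self _ _)) (fun h0 => h0A (h0 ▸ hm₀)) hC (hφh l hl)
  · rw [← hpQ]; exact nsmul_mem_of_mem_refinedLattice htΛ hx
  · have hx0 : x ≠ 0 := by rintro rfl; simpa using hx.1
    refine le_trans ?_ (hstep l hl x hx0 hx.2 i)
    have := sub_nonneg.2 hDQ
    positivity
  · refine Λ'.add_mem ?_ hxΛ
    rcases hu with rfl | rfl
    · exact self_mem_refinedLattice
    · exact Λ'.neg_mem self_mem_refinedLattice
  · have hl0 : l ∈ Set.Icc 1 s := ⟨hl.1, hl.2.le⟩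
    have hl1 : l + 1 ∈ Set.Icc 1 s := ⟨by omega, hl.2⟩
    have hxh := (hcone l hl0 x).1 hx
    have hxA := hmemA l hl0 x hx0 hxh
    -- A multiple of `τ` inside `int A` is impossible: a nonpositive one contradicts `φ x > 0`, a
    -- positive one `τ ∉ A`.
    have hne : x ≠ g₀ x • τ := by
      intro heq
      rcases le_or_gt (g₀ x) 0 with hle | hgt
      · have h1 := hφh' l hl0 x hx0 hxh
        rw [heq, map_smul, smul_eq_mul] at h1
        nlinarith
      · refine hτA ?_
        have : τ = (g₀ x)⁻¹ • x := by
          rw [eq_inv_smul_iff₀ hgt.ne']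
          exact heq.symm
        rw [this]
        exact A.smul_mem (inv_nonneg.2 hgt.le) (interior_subset hxA)
    have hρ1 : ρ ≤ p * ‖x‖ := by
      refine hρx x p hp0 ?_ hne
      obtain ⟨w, hw, k, hk⟩ := mem_refinedLattice.1 hxΛ
      -- The projection along `τ` forgets the multiple of `t`, so only the part of `x` in `Λ / p`
      -- matters.
      have h1 : x - g₀ x • τ = w - g₀ w • τ := by
        have : g₀ t • τ = t := by
          rw [ht, map_smul, hg₀τ, smul_eq_mul, mul_one]
        rw [← hk, map_add, map_zsmul, add_smul, smul_assoc, this]; abel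
      obtain ⟨z, hz⟩ := hg₀ _ hw
      have h2 : p • (w - g₀ w • τ) = p • w - z • τ := by
        rw [smul_sub, ← Int.cast_smul_eq_zsmul ℝ, ← hz, map_nsmul, smul_assoc]
      rw [h1, h2]
      exact Λ.sub_mem hw (Λ.zsmul_mem hτΛ z)
    -- The value exceeds `1 = |h (l + 1) i t|`, so adding `±t` leaves all inequalities strict.
    have hbig : ∀ i, 1 < h (l + 1) i x := by
      intro i
      refine lt_of_lt_of_le ?_ (hstep l hl x hx0 hxh i)
      calc 1 < (Q * η - D) * ρ := hρQ
        _ ≤ (Q * η - D) * (p * ‖x‖) := by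
          have := sub_nonneg.2 hDQ
          gcongr
        _ = _ := by ring
    have hopen : IsOpen {y : E | ∀ i, 0 < h (l + 1) i y} := by
      rw [Set.ofPred_forall]
      exact isOpen_iInter_of_finite fun i =>
        isOpen_lt continuous_const (h (l + 1) i).continuous_of_finiteDimensional
    refine interior_maximal (fun y hy => (hcone _ hl1 y).2 fun i => (hy i).le) hopen fun i => ?_
    have h1 := hbig i
    rw [map_add]
    rcases hu with rfl | rfl
    · rcases hht' _ hl1 i with h2 | h2 <;> linarith
    · rw [map_neg]
      rcases hht' _ hl1 i with h2 | h2 <;> linarith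
  · exact mem_refinedLattice_of_nsmul_mem (hj x (Finset.mem_union_left _ hx))
  · refine mem_cone_singleton_sup.2 ⟨a x * (p * Q : ℕ), mul_nonneg (ha x hx) hpQR.le, m x,
      hY'1 _ (Finset.mem_insert_of_mem (Finset.mem_union_right _ (Finset.mem_image_of_mem _ hx))), ?_⟩
    rw [mul_smul, Nat.cast_smul_eq_nsmul, htτ, hXm x hx]
  · exact mem_sub_joinMonoid.2 ⟨mem_refinedLattice_of_nsmul_mem (hj y (Finset.mem_union_right _ hy)),
      hY'1 _ (Finset.mem_insert_of_mem (Finset.mem_union_left _ hy))⟩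

/-! ### Exhaustion by chains and the countable target monoids -/

/-- Enumerate `A` and `B`; each next index captures the finite generating sets of the current two
monoids together with the next enumerated elements. One sequence of indices serves both chains. -/
theorem exists_monotone_exhaustion {E ι : Type*} [AddCommMonoid E] {L S : ι → AddSubmonoid E}
    (hL : ∀ i, (L i).FG) (hS : ∀ i, (S i).FG) {A B : Set E} (hA : A.Countable) (hB : B.Countable)
    (hA0 : 0 ∈ A) (hB0 : 0 ∈ B) (hLA : ∀ i, (L i : Set E) ⊆ A) (hSB : ∀ i, (S i : Set E) ⊆ B)
    (h : ∀ X Y : Finset E, (X : Set E) ⊆ A → (Y : Set E) ⊆ B →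
      ∃ i, (X : Set E) ⊆ L i ∧ (Y : Set E) ⊆ S i) :
    ∃ a : ℕ → ι, (Monotone fun n => L (a n)) ∧ (Monotone fun n => S (a n)) ∧
      (⋃ n, (L (a n) : Set E)) = A ∧ (⋃ n, (S (a n) : Set E)) = B := by
  classical
  obtain ⟨f, rfl⟩ := hA.exists_eq_range ⟨0, hA0⟩
  obtain ⟨g, rfl⟩ := hB.exists_eq_range ⟨0, hB0⟩
  have hstep : ∀ (n : ℕ) (i : ι), ∃ k, L i ≤ L k ∧ S i ≤ S k ∧ f n ∈ L k ∧ g n ∈ S k := by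
    intro n i
    obtain ⟨X, hX⟩ := hL i
    obtain ⟨Y, hY⟩ := hS i
    obtain ⟨k, hk1, hk2⟩ := h (insert (f n) X) (insert (g n) Y) (by
      rw [Finset.coe_insert, Set.insert_subset_iff]
      exact ⟨⟨n, rfl⟩, fun x hx => hLA i (hX ▸ AddSubmonoid.subset_closure hx)⟩) (by
      rw [Finset.coe_insert, Set.insert_subset_iff]
      exact ⟨⟨n, rfl⟩, fun x hx => hSB i (hY ▸ AddSubmonoid.subset_closure hx)⟩)
    rw [Finset.coe_insert, Set.insert_subset_iff] at hk1 hk2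
    exact ⟨k, hX ▸ (AddSubmonoid.closure_le.2 hk1.2), hY ▸ (AddSubmonoid.closure_le.2 hk2.2),
      hk1.1, hk2.1⟩
  choose F hFL hFS hFf hFg using hstep
  obtain ⟨i₀, -⟩ := h ∅ ∅ (by simp) (by simp)
  let a : ℕ → ι := fun n => Nat.rec i₀ (fun n i => F n i) n
  have ha : ∀ n, a (n + 1) = F n (a n) := fun n => rfl
  refine ⟨a, monotone_nat_of_le_succ fun n => ha n ▸ hFL _ _,
    monotone_nat_of_le_succ fun n => ha n ▸ hFS _ _, ?_, ?_⟩
  · refine (Set.iUnion_subset fun n => hLA _).antisymm ?_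
    rintro _ ⟨n, rfl⟩
    exact Set.mem_iUnion.2 ⟨n + 1, ha n ▸ hFf _ _⟩
  · refine (Set.iUnion_subset fun n => hSB _).antisymm ?_
    rintro _ ⟨n, rfl⟩
    exact Set.mem_iUnion.2 ⟨n + 1, ha n ▸ hFg _ _⟩

theorem cone_divMonoid {c : ℕ → ℕ} (hc : ∀ i, 0 < c i) (M : AddSubmonoid E) :
    cone (divMonoid c M : Set E) = cone (M : Set E) := by
  refine le_antisymm (cone_le.2 ?_) (cone_mono fun x hx => ⟨0, by simpa using hx⟩)
  rintro x ⟨j, hj⟩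
  have hp : (0 : ℝ) < (∏ i ∈ Finset.range j, c i : ℕ) :=
    Nat.cast_pos.2 (Finset.prod_pos fun i _ => hc i)
  have := (cone (M : Set E)).smul_mem (inv_nonneg.2 hp.le) (subset_cone _ hj)
  rwa [← Nat.cast_smul_eq_nsmul ℝ, smul_smul, inv_mul_cancel₀ hp.ne', one_smul] at this

/-- In the interior of the cone, membership depends on the lattice alone: an interior lattice point
has a positive multiple in `M`, hence lies in `M` by normality. -/
theorem mem_interiorMonoid_divMonoid [FiniteDimensional ℝ E] {c : ℕ → ℕ} (hc : ∀ i, 0 < c i)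
    {M : AddSubmonoid E} (hM : IsAffineNormal M) (hspan : Submodule.span ℝ (gp M : Set E) = ⊤)
    {x : E} : x ∈ interiorMonoid (divMonoid c M) ↔
      x = 0 ∨ ((∃ j, (∏ i ∈ Finset.range j, c i) • x ∈ gp M) ∧
        x ∈ interior (cone (M : Set E) : Set E)) := by
  have := hM.discrete
  unfold interiorMonoid interiorPart
  rw [cone_divMonoid hc, intrinsicInterior_eq_interior
    (affineSpan_cone_eq_top (span_eq_top_of_gp hspan))]
  constructor
  · rintro (⟨⟨j, hj⟩, hx⟩ | rfl)
    · exact Or.inr ⟨⟨j, AddSubgroup.subset_closure hj⟩, hx⟩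
    · exact Or.inl rfl
  · rintro (rfl | ⟨⟨j, hj⟩, hx⟩)
    · exact Or.inr rfl
    · refine Or.inl ⟨⟨j, ?_⟩, hx⟩
      have hp : 0 < ∏ i ∈ Finset.range j, c i := Finset.prod_pos fun i _ => hc i
      have hx' : (∏ i ∈ Finset.range j, c i) • x ∈ interior (cone (M : Set E) : Set E) := by
        rw [← Nat.cast_smul_eq_nsmul ℝ]
        exact smul_mem_interior hx (Nat.cast_pos.2 hp)
      obtain ⟨k, hk, hkx⟩ := mem_rationalHull_of_mem_interior hspan ⟨1, one_pos, by simpa using hj⟩ hx'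
      exact hM.normal _ hj k hk hkx

theorem countable_setOf_nsmul_mem [FiniteDimensional ℝ E] (Λ : AddSubgroup E)
    [DiscreteTopology Λ] {c : ℕ → ℕ} (hc : ∀ i, 0 < c i) :
    {x : E | ∃ j, (∏ i ∈ Finset.range j, c i) • x ∈ Λ}.Countable := by
  have hd : DiscreteTopology (AddSubgroup.toIntSubmodule Λ) := ‹DiscreteTopology Λ›
  have hfin : Module.Finite ℤ (AddSubgroup.toIntSubmodule Λ) := inferInstance
  have hΛ : (Λ : Set E).Countable :=
    show Countable (AddSubgroup.toIntSubmodule Λ) from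
      Finsupp.Countable.of_moduleFinite (R := ℤ)
  rw [Set.ofPred_exists]
  refine Set.countable_iUnion fun j => hΛ.preimage_of_injOn (f := fun x =>
    (∏ i ∈ Finset.range j, c i) • x) fun x _ y _ hxy => ?_
  have hp : ((∏ i ∈ Finset.range j, c i : ℕ) : ℝ) ≠ 0 :=
    Nat.cast_ne_zero.2 (Finset.prod_pos fun i _ => hc i).ne'
  simp only [← Nat.cast_smul_eq_nsmul ℝ] at hxy
  exact smul_right_injective E hp hxy

end MonoidGeom

/-! ### The main theorem -/

open MonoidGeom
theorem mainTheorem7 {E : Type*} [NormedAddCommGroup E] [NormedSpace ℝ E] [FiniteDimensional ℝ E]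
    (M N : AddSubmonoid E)
    (hspan : Submodule.span ℝ (N : Set E) = ⊤)
    (φ : E →ₗ[ℝ] ℝ) (hφ : IsCrossSection φ N)
    (hMN : IsPyramidalExtension φ M N)
    (c : ℕ → ℕ) (hc : ∀ i, 2 ≤ c i)
    (s : ℕ) (hs : 1 ≤ s) :
    ∃ (t : ℕ → E) (Γ : ℕ → ℕ → Set E) (L : ℕ → ℕ → AddSubmonoid E),
      (∀ α, ∀ l ∈ Set.Icc 1 s, IsPolarized φ (t α) (Γ l α) (L l α)) ∧
      (∀ α, (∀ l ∈ Set.Ico 1 s, L l α ≤ L (l + 1) α) ∧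
        (L s α : Set E) ⊆ interiorMonoid (divMonoid c N) ∧
        (∀ l ∈ Set.Ico 1 s, Γ l α ⊆ Γ (l + 1) α) ∧
        Γ s α ⊆ intrinsicInterior ℝ (Phi φ M)) ∧
      (∀ α, ∀ l ∈ Set.Ico 1 s, ∀ x ∈ sub (L l α) (Γ l α), x ≠ 0 →
        t α + x ∈ interiorPart (sub (L (l + 1) α) (Γ (l + 1) α)) ∧
        -t α + x ∈ interiorPart (sub (L (l + 1) α) (Γ (l + 1) α))) ∧
      (Directed (· ≤ ·) (fun α => sub (L 1 α) (Γ 1 α)) ∧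
        (⋃ α, (sub (L 1 α) (Γ 1 α) : Set E)) = interiorMonoid (divMonoid c M)) ∧
      (Directed (· ≤ ·) (fun α => L 1 α) ∧
        (⋃ α, (L 1 α : Set E)) = interiorMonoid (divMonoid c N)) := by
  classical
  have hc0 : ∀ i, 0 < c i := fun i => two_pos.trans_le (hc i)
  have hdN : DiscreteTopology (gp N) := hMN.right.discrete
  have hspanN : Submodule.span ℝ (gp N : Set E) = ⊤ :=
    top_le_iff.1 (hspan ▸ Submodule.span_mono AddSubgroup.subset_closure)
  have hspanM : Submodule.span ℝ (gp M : Set E) = ⊤ := by rw [hMN.gp_eq]; exact hspanN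
  obtain ⟨v, hvN, hφv, hvM, hdec⟩ := hMN.exists_apex hφ
  obtain ⟨C, hC, hφC⟩ := hφ.exists_norm_le hMN.right.fg
  have hφΛ : ∀ y ∈ gp N, ∃ q : ℚ, φ y = q := by
    intro y hy
    induction hy using AddSubgroup.closure_induction with
    | mem x hx => exact hφ.rational x hx
    | zero => exact ⟨0, by simp⟩
    | add x y _ _ hx hy =>
      obtain ⟨q, hq⟩ := hx
      obtain ⟨r, hr⟩ := hy
      exact ⟨q + r, by simp [hq, hr]⟩
    | neg x _ hx =>
      obtain ⟨q, hq⟩ := hx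
      exact ⟨-q, by simp [hq]⟩
  have hMN' : cone (M : Set E) ≤ cone (N : Set E) := cone_mono hMN.le
  have hvM' := eventually_notMem_cone hMN.left.fg (fun x hx => hφ.pos x (hMN.le hx)) hvM hφv
  have hmemM : ∀ {x}, x ∈ interiorMonoid (divMonoid c M) ↔ x = 0 ∨
      ((∃ j, (∏ i ∈ Finset.range j, c i) • x ∈ gp N) ∧
        x ∈ interior (cone (M : Set E) : Set E)) := by
    intro x
    rw [← hMN.gp_eq]; exact mem_interiorMonoid_divMonoid hc0 hMN.left hspanM
  have hmemN : ∀ {x}, x ∈ interiorMonoid (divMonoid c N) ↔ x = 0 ∨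
      ((∃ j, (∏ i ∈ Finset.range j, c i) • x ∈ gp N) ∧
        x ∈ interior (cone (N : Set E) : Set E)) :=
    mem_interiorMonoid_divMonoid hc0 hMN.right hspanN
  -- The systems are indexed by all pairs of finite sets. Zero is erased because it is not an
  -- interior point; it lies in every monoid anyway.
  have key : ∀ XY : {XY : Finset E × Finset E //
      (XY.1 : Set E) ⊆ interiorMonoid (divMonoid c N) ∧
      (XY.2 : Set E) ⊆ interiorMonoid (divMonoid c M)}, _ := fun XY =>
    exists_polarized_system hspanN hMN' (interior_cone_nonempty (span_eq_top_of_gp hspanM)) hvN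
      hvM' hdec hφΛ hC hφC hc hs (X := XY.1.1.erase 0) (Y := XY.1.2.erase 0)
      (fun x hx => (((hmemN.1 (XY.2.1 (Finset.mem_of_mem_erase hx))).resolve_left
        (Finset.ne_of_mem_erase hx))).2)
      (fun x hx => (((hmemN.1 (XY.2.1 (Finset.mem_of_mem_erase hx))).resolve_left
        (Finset.ne_of_mem_erase hx))).1)
      (fun x hx => (((hmemM.1 (XY.2.2 (Finset.mem_of_mem_erase hx))).resolve_left
        (Finset.ne_of_mem_erase hx))).2)
      (fun x hx => (((hmemM.1 (XY.2.2 (Finset.mem_of_mem_erase hx))).resolve_left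
        (Finset.ne_of_mem_erase hx))).1)
  choose t Γ Λ hpol hΛ htN hΓM hΓ hshift hX hY using key
  have h1s : 1 ∈ Set.Icc 1 s := ⟨le_rfl, hs⟩
  have hLN : ∀ XY, ∀ l ∈ Set.Icc 1 s,
      (joinMonoid (Λ XY) (t XY) (Γ XY l) : Set E) ⊆ interiorMonoid (divMonoid c N) := by
    rintro XY l hl x ⟨hxΛ, hx⟩
    by_cases hx0 : x = 0
    · exact hmemN.2 (Or.inl hx0)
    refine hmemN.2 (Or.inr ⟨hΛ XY x hxΛ, ?_⟩)
    obtain ⟨a, ha, y, hy, rfl⟩ := mem_cone_singleton_sup.1 hx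
    by_cases hy0 : y = 0
    · subst hy0
      have ha0 : a ≠ 0 := by rintro rfl; simp at hx0
      rw [add_zero]
      exact smul_mem_interior (htN XY) (lt_of_le_of_ne ha ha0.symm)
    · exact add_mem_interior ((cone _).smul_mem ha (interior_subset (htN XY)))
        (interior_mono hMN' (hΓM XY l hl y hy hy0))
  have hSM : ∀ XY, (sub (joinMonoid (Λ XY) (t XY) (Γ XY 1)) (Γ XY 1) : Set E) ⊆
      interiorMonoid (divMonoid c M) := by
    intro XY x hx
    obtain ⟨hxΛ, hx⟩ := mem_sub_joinMonoid.1 hx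
    by_cases hx0 : x = 0
    · exact hmemM.2 (Or.inl hx0)
    · exact hmemM.2 (Or.inr ⟨hΛ XY x hxΛ, hΓM XY 1 h1s x hx hx0⟩)
  have hcount := countable_setOf_nsmul_mem (gp N) hc0
  obtain ⟨a, haL, haS, haN, haM⟩ := exists_monotone_exhaustion
    (L := fun XY => joinMonoid (Λ XY) (t XY) (Γ XY 1))
    (S := fun XY => sub (joinMonoid (Λ XY) (t XY) (Γ XY 1)) (Γ XY 1))
    (A := interiorMonoid (divMonoid c N)) (B := interiorMonoid (divMonoid c M))
    (fun XY => (hpol XY 1 h1s).1.affineNormal.fg) (fun XY => (hpol XY 1 h1s).2.2)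
    (hcount.mono fun x hx => by
      rcases hmemN.1 hx with rfl | h
      · exact ⟨0, by simp⟩
      · exact h.1)
    (hcount.mono fun x hx => by
      rcases hmemM.1 hx with rfl | h
      · exact ⟨0, by simp⟩
      · exact h.1)
    (hmemN.2 (Or.inl rfl)) (hmemM.2 (Or.inl rfl)) (fun XY => hLN XY 1 h1s) hSM
    (fun X Y hXN hYM => by
      refine ⟨⟨(X, Y), hXN, hYM⟩, fun x hx => ?_, fun y hy => ?_⟩
      · by_cases hx0 : x = 0
        · rw [hx0]; exact zero_mem _
        · exact hX _ x (Finset.mem_erase.2 ⟨hx0, hx⟩)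
      · by_cases hy0 : y = 0
        · rw [hy0]; exact zero_mem _
        · exact hY _ y (Finset.mem_erase.2 ⟨hy0, hy⟩))
  refine ⟨fun α => t (a α), fun l α => Γ (a α) l,
    fun l α => joinMonoid (Λ (a α)) (t (a α)) (Γ (a α) l), fun α l hl => (hpol (a α) l hl).1,
    fun α => ⟨fun l hl => ?_, hLN (a α) s ⟨hs, le_rfl⟩, hΓ (a α), fun x hx => ?_⟩,
    fun α l hl x hx hx0 => ?_, ⟨haS.directed_le, haM⟩, ⟨haL.directed_le, haN⟩⟩
  · exact inf_le_inf_left _ (sup_le_sup_left (cone_mono (hΓ (a α) l hl)) (cone {t (a α)}))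
  · have hφx : φ x = 1 := ((hpol (a α) s ⟨hs, le_rfl⟩).1.subset hx).2
    refine mem_intrinsicInterior_Phi (hΓM (a α) s ⟨hs, le_rfl⟩ x (subset_cone _ hx) ?_) hφx
    rintro rfl
    simp at hφx
  · obtain ⟨hxΛ, hxΓ⟩ := mem_sub_joinMonoid.1 hx
    have hmem : ∀ u, u = t (a α) ∨ u = -t (a α) → u + x ∈ interiorPart
        (sub (joinMonoid (Λ (a α)) (t (a α)) (Γ (a α) (l + 1))) (Γ (a α) (l + 1))) := by
      intro u hu
      obtain ⟨h1, h2⟩ := hshift (a α) l hl x hxΛ hxΓ hx0 u hu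
      refine ⟨mem_sub_joinMonoid.2 ⟨h1, interior_subset h2⟩, ?_⟩
      rw [(hpol (a α) (l + 1) ⟨by omega, hl.2⟩).2.1]
      exact interior_subset_intrinsicInterior h2
    exact ⟨hmem _ (Or.inl rfl), hmem _ (Or.inr rfl)⟩
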